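/- Let $\gamma$ be an irreducible circular cubic in $\mathbb{RP}^2$, that is, a curve defined by an irreducible homogeneous polynomial $F\in\mathbb{R}[x,y,z]$ of degree three that vanishes at the circular points $\alpha=[i:1:0]$ and $\beta=[-i:1:0]$ of $\mathbb{CP}^2$. Let $\gamma^*$ be the set of regular real points of $\gamma$, and let $o\in\gamma^*$ be the unique real point of $\gamma$ on the line at infinity $z=0$. For $p,q\in\gamma^*$ let $p*q\in\gamma^*$ be the third intersection point (counted with multiplicity) of $\gamma$ with the line $pq$, which is the tangent line to $\gamma$ at $p$ if $p=q$. Let $p\oplus q=(p*q)*o$ be the group law on $\gamma^*$ with identity $o$, and let $\omega=o*o$ be the third intersection point of $\gamma$ with its tangent line at $o$. A generalised circle is a real algebraic curve of degree two that contains $\alpha$ and $\beta$ (for example, a circle, or the union of a line with the line at infinity). Let $a,b,c,d\in\gamma^*$ be points that are not necessarily distinct. There is a generalised circle whose real intersection points with $\gamma$, counted with multiplicity, are exactly $a,b,c,d$ if and only if $$a\oplus b\oplus c\oplus d=\omega .$$ -/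

import Mathlib

open MvPolynomial

/-- The real projective plane, with homogeneous coordinates `[x : y : z]` indexed by `0, 1, 2`. -/
abbrev RP2 : Type := Projectivization ℝ (Fin 3 → ℝ)

/-- The real projective curve with equation `F` contains both circular points
`α = [i : 1 : 0]` and `β = [-i : 1 : 0]` of the complex projective plane. -/
def ContainsCircularPoints (F : MvPolynomial (Fin 3) ℝ) : Prop :=
  aeval ![Complex.I, 1, 0] F = 0 ∧ aeval ![-Complex.I, 1, 0] F = 0

/-- `Q` is an equation of a generalised circle: a real algebraic curve of degree two
containing both circular points. -/
def IsGeneralisedCircle (Q : MvPolynomial (Fin 3) ℝ) : Prop :=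
  Q ≠ 0 ∧ Q.IsHomogeneous 2 ∧ ContainsCircularPoints Q

/-- `F` is an equation of an irreducible circular cubic: an irreducible real algebraic curve
of degree three containing both circular points. -/
structure IsIrreducibleCircularCubic (F : MvPolynomial (Fin 3) ℝ) : Prop where
  irreducible : Irreducible F
  isHomogeneous : F.IsHomogeneous 3
  containsCircularPoints : ContainsCircularPoints F

/-- The point `p` lies on the curve with (homogeneous) equation `F`. -/
def OnCurve (F : MvPolynomial (Fin 3) ℝ) (p : RP2) : Prop :=
  eval p.rep F = 0

/-- The point `p` is a regular point of the curve with (homogeneous) equation `F`: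
it lies on the curve and some first partial derivative of `F` does not vanish there. -/
def IsRegularPoint (F : MvPolynomial (Fin 3) ℝ) (p : RP2) : Prop :=
  OnCurve F p ∧ ∃ i, eval p.rep (pderiv i F) ≠ 0

/-- The set `γ*` of regular real points of the curve `γ` with equation `F`. -/
def RegularPoint (F : MvPolynomial (Fin 3) ℝ) : Type :=
  {p : RP2 // IsRegularPoint F p}

/-- The ideal of all polynomials vanishing at (a representative of) `p`. Its `m`-th power
consists of the polynomials vanishing there to order at least `m`. -/
noncomputable def pointIdeal (p : RP2) : Ideal (MvPolynomial (Fin 3) ℝ) :=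
  RingHom.ker (eval p.rep)

/-- The intersection multiplicity, at a regular point `p` of the curve `γ : F = 0`, of `γ` with the
curve `G = 0`. It is the order of vanishing at `p` of `G` restricted to `γ` (the order in the
discrete valuation ring `𝓞_{γ,p}`): the largest `m` such that `G` agrees modulo `F` with a
polynomial vanishing to order at least `m` at `p`, and `⊤` if there is no largest one. -/
noncomputable def intersectionMultiplicity (F G : MvPolynomial (Fin 3) ℝ)
    (p : RegularPoint F) : ℕ∞ :=
  ⨆ (m : ℕ) (_ : G ∈ Ideal.span {F} ⊔ pointIdeal p.1 ^ m), (m : ℕ∞)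

open Classical in
/-- The curve `G = 0` intersects the curve `γ : F = 0` in the real projective plane in exactly the
regular points listed in `s`, counted with multiplicity: every common real point is a regular point
of `γ`, and the intersection multiplicity at each regular point is the number of times that the
point is listed. -/
def IntersectsExactlyIn (F G : MvPolynomial (Fin 3) ℝ) (s : Multiset (RegularPoint F)) : Prop :=
  (∀ p : RP2, OnCurve F p → OnCurve G p → IsRegularPoint F p) ∧
    ∀ p : RegularPoint F, intersectionMultiplicity F G p = (s.count p : ℕ∞)

/-- Some line `L = 0` intersects the curve `F = 0` in exactly `a, b, c`, counted with multiplicity.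
(If `a = b`, this forces the line to be the tangent line at `a`.) -/
def IsLineSection (F : MvPolynomial (Fin 3) ℝ) (a b c : RegularPoint F) : Prop :=
  ∃ L : MvPolynomial (Fin 3) ℝ, L ≠ 0 ∧ L.IsHomogeneous 1 ∧ IntersectsExactlyIn F L {a, b, c}

/-- The point `a * b`: the third intersection point of the curve `F = 0` with the line through
`a` and `b` (the tangent line if `a = b`). For an irreducible cubic there is exactly one. -/
noncomputable def thirdPoint {F : MvPolynomial (Fin 3) ℝ} (a b : RegularPoint F) :
    RegularPoint F :=
  @Classical.epsilon _ ⟨a⟩ (fun c => IsLineSection F a b c)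

/-! The real point at infinity -/

theorem exists_decomposition (F : MvPolynomial (Fin 3) ℝ) (hF : F.IsHomogeneous 3) :
    ∃ (G : MvPolynomial (Fin 3) ℝ) (a b c d : ℝ),
      F = X 2 * G + (C a * X 0 ^ 3 + C b * (X 0 ^ 2 * X 1) + C c * (X 0 * X 1 ^ 2)
        + C d * X 1 ^ 3) := by
  rw [← F.support_sum_monomial_coeff]
  refine Finset.sum_induction _ (fun H : MvPolynomial (Fin 3) ℝ => ∃ (G : MvPolynomial (Fin 3) ℝ)
    (a b c d : ℝ), H = X 2 * G + (C a * X 0 ^ 3 + C b * (X 0 ^ 2 * X 1) + C c * (X 0 * X 1 ^ 2)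
        + C d * X 1 ^ 3)) ?_ ?_ ?_
  · rintro _ _ ⟨G, a, b, c, d, rfl⟩ ⟨G', a', b', c', d', rfl⟩
    exact ⟨G + G', a + a', b + b', c + c', d + d', by simp only [C_add]; ring⟩
  · exact ⟨0, 0, 0, 0, 0, by simp⟩
  · intro s hs
    have hdeg : s 0 + s 1 + s 2 = 3 := by
      have h := hF (mem_support_iff.mp hs)
      simpa [Finsupp.weight_apply, Finsupp.sum_fintype, Fin.sum_univ_three] using h
    have hmon : monomial s (coeff s F) = C (coeff s F) * (X 0 ^ s 0 * X 1 ^ s 1 * X 2 ^ s 2) := by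
      rw [monomial_eq, Finsupp.prod_fintype _ _ (by simp), Fin.prod_univ_three]
    rw [hmon]
    generalize coeff s F = k
    rcases Nat.eq_zero_or_pos (s 2) with h2 | h2
    · have h1 : s 1 = 3 - s 0 := by omega
      have h0 : s 0 ≤ 3 := by omega
      rw [h2, h1]
      interval_cases s 0
      · exact ⟨0, 0, 0, 0, k, by simp⟩
      · exact ⟨0, 0, 0, k, 0, by simp⟩
      · exact ⟨0, 0, k, 0, 0, by simp⟩
      · exact ⟨0, k, 0, 0, 0, by simp⟩
    · obtain ⟨n, hn⟩ := Nat.exists_eq_add_of_lt h2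
      refine ⟨C k * (X 0 ^ s 0 * X 1 ^ s 1 * X 2 ^ n), 0, 0, 0, 0, ?_⟩
      rw [hn]
      simp only [C_0]
      ring

/-- An irreducible circular cubic has an equation `(u x + v y) (x² + y²) + z q(x, y, z)`
with `u`, `v` not both zero. -/
theorem IsIrreducibleCircularCubic.exists_eq {F : MvPolynomial (Fin 3) ℝ}
    (hF : IsIrreducibleCircularCubic F) :
    ∃ (G : MvPolynomial (Fin 3) ℝ) (u v : ℝ), u ^ 2 + v ^ 2 ≠ 0 ∧
      F = X 2 * G + (C u * X 0 + C v * X 1) * (X 0 ^ 2 + X 1 ^ 2) := by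
  obtain ⟨G, a, b, c, d, h⟩ := exists_decomposition F hF.isHomogeneous
  have hα := hF.containsCircularPoints.1
  rw [h] at hα
  simp only [map_add, map_mul, map_pow, aeval_X, algHom_C] at hα
  simp [pow_succ] at hα
  have hre := congrArg Complex.re hα
  have him := congrArg Complex.im hα
  simp at hre him
  have hdb : d = b := by linarith
  have hca : c = a := by linarith
  subst hdb hca
  refine ⟨G, c, d, ?_, by rw [h]; ring⟩
  intro h0
  have hc : c = 0 := by nlinarith [sq_nonneg c, sq_nonneg d]
  have hd : d = 0 := by nlinarith [sq_nonneg c, sq_nonneg d]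
  subst hc hd
  have hXG : F = X 2 * G := by rw [h]; simp
  rcases hF.irreducible.isUnit_or_isUnit hXG with hu | hu
  · have := hu.map (eval (0 : Fin 3 → ℝ))
    simp at this
  · obtain ⟨r, hr⟩ : ∃ r : ℝ, G = C r :=
      ⟨_, (MvPolynomial.totalDegree_eq_zero_iff_eq_C).1
        (MvPolynomial.isUnit_iff_totalDegree_of_isReduced.1 hu).2⟩
    have h1 : F.IsHomogeneous 1 := by
      rw [hXG, hr]
      exact (isHomogeneous_X ℝ 2).mul (isHomogeneous_C _ r)
    have := h1.inj_right hF.isHomogeneous hF.irreducible.ne_zero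
    omega

/-- A circular irreducible cubic has exactly one real point on the line at infinity `z = 0`. -/
theorem IsIrreducibleCircularCubic.existsUnique_atInfinity {F : MvPolynomial (Fin 3) ℝ}
    (hF : IsIrreducibleCircularCubic F) : ∃! p : RP2, OnCurve F p ∧ p.rep 2 = 0 := by
  obtain ⟨G, u, v, huv, h⟩ := hF.exists_eq
  have hw : (![v, -u, 0] : Fin 3 → ℝ) ≠ 0 := by
    intro h0
    have h1 := congrFun h0 0
    have h2 := congrFun h0 1
    simp at h1 h2
    simp [h1, h2] at huv
  refine ⟨Projectivization.mk ℝ _ hw, ?_, ?_⟩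
  · obtain ⟨k, hk⟩ := Projectivization.exists_smul_eq_mk_rep ℝ _ hw
    constructor
    · rw [OnCurve, ← hk, h]
      simp [Units.smul_def]
      left
      ring
    · rw [← hk]
      simp
  · rintro p ⟨hp, hz⟩
    have hne := p.rep_nonzero
    rw [OnCurve, h] at hp
    simp [hz] at hp
    have hxy : p.rep 0 ^ 2 + p.rep 1 ^ 2 ≠ 0 := by
      intro h0
      apply hne
      funext i
      have h1 : p.rep 0 = 0 := by nlinarith [sq_nonneg (p.rep 0), sq_nonneg (p.rep 1)]
      have h2 : p.rep 1 = 0 := by nlinarith [sq_nonneg (p.rep 0), sq_nonneg (p.rep 1)]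
      fin_cases i <;> simp [h1, h2, hz]
    have hl : u * p.rep 0 + v * p.rep 1 = 0 := hp.resolve_right hxy
    rw [← p.mk_rep, Projectivization.mk_eq_mk_iff']
    refine ⟨(v * p.rep 0 - u * p.rep 1) / (u ^ 2 + v ^ 2), ?_⟩
    funext i
    fin_cases i
    · simp
      field_simp
      linear_combination (-u) * hl
    · simp
      field_simp
      linear_combination (-v) * hl
    · simp [hz]

theorem IsIrreducibleCircularCubic.isRegularPoint_of_atInfinity {F : MvPolynomial (Fin 3) ℝ}
    (hF : IsIrreducibleCircularCubic F) {p : RP2} (hp : OnCurve F p) (hz : p.rep 2 = 0) :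
    IsRegularPoint F p := by
  refine ⟨hp, ?_⟩
  by_contra! hcon
  obtain ⟨G, u, v, huv, h⟩ := hF.exists_eq
  have h0 := hcon 0
  have h1 := hcon 1
  rw [OnCurve, h] at hp
  rw [h] at h0 h1
  simp [hz, pderiv_X] at hp h0 h1
  have hne := p.rep_nonzero
  have hxy : p.rep 0 ^ 2 + p.rep 1 ^ 2 ≠ 0 := by
    intro h0
    apply hne
    funext i
    have h1 : p.rep 0 = 0 := by nlinarith [sq_nonneg (p.rep 0), sq_nonneg (p.rep 1)]
    have h2 : p.rep 1 = 0 := by nlinarith [sq_nonneg (p.rep 0), sq_nonneg (p.rep 1)]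
    fin_cases i <;> simp [h1, h2, hz]
  have hl : u * p.rep 0 + v * p.rep 1 = 0 := hp.resolve_right hxy
  rw [hl] at h0 h1
  simp [hxy] at h0 h1
  simp [h0, h1] at huv

/-- The identity element `o`: the unique real point at infinity of an irreducible circular cubic. -/
noncomputable def identityPoint {F : MvPolynomial (Fin 3) ℝ} (hF : IsIrreducibleCircularCubic F) :
    RegularPoint F :=
  ⟨hF.existsUnique_atInfinity.choose,
    hF.isRegularPoint_of_atInfinity hF.existsUnique_atInfinity.choose_spec.1.1
      hF.existsUnique_atInfinity.choose_spec.1.2⟩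

/-- The group operation `a ⊕ b = (a * b) * o`. -/
noncomputable def groupSum {F : MvPolynomial (Fin 3) ℝ} (hF : IsIrreducibleCircularCubic F)
    (a b : RegularPoint F) : RegularPoint F :=
  thirdPoint (thirdPoint a b) (identityPoint hF)

/-- The point `ω = o * o`: the third intersection point of the curve with its tangent line
at `o`. -/
noncomputable def omegaPoint {F : MvPolynomial (Fin 3) ℝ} (hF : IsIrreducibleCircularCubic F) :
    RegularPoint F :=
  thirdPoint (identityPoint hF) (identityPoint hF)

/-! Put `p = a * b`, `q = c * d`. Cancelling one operation at a time turns the group equation into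
the collinearity of `p`, `q`, `o` (`groupSum_eq_omegaPoint_iff`); associativity of the group law is
never used. Let `L₁`, `L₂` be the lines through `a, b, p` and `c, d, q`. The real intersection of `z
= 0` with the cubic is `o`, counted once.

If a line `L₃` cuts out `p, q, o`, then `L₁ L₂ z` meets the cubic at least where `L₃` does, so `L₁
L₂ z - r F = L₃ Q` for some constant `r`. The conic `Q` takes up the remaining points `a, b, c, d`.
At the circular points `z` and `F` vanish and `L₃` does not, so `Q` vanishes there. Conversely,
given `Q` and the line `L₃` through `p, q` with third point `r`, the same division gives `L₃ Q - s F
= L₁ M` and then `M = L₂ N`. The line `N` passes through `r` and a circular point; being real it is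
`z = 0`, whence `r = o`.

Two tools carry this. Multiplicities at regular points add (`intersectionMultiplicity_mul`), because
the associated graded ring of the local ring is a domain. A form whose multiplicities dominate those
of a line is divisible by the line up to a multiple of `F` (`exists_linearForm_dvd_sub`), because
its restriction to the line has too many roots; here the multiplicity of a line is a root
multiplicity of the restricted cubic. -/

/-! ### Taylor expansion and order of vanishing at a point -/

section Dilation

variable {K σ : Type*} [Field K]

/-- The ideal of polynomials vanishing at the point `x` of affine space. -/
noncomputable def vanishingIdealAt (x : σ → K) : Ideal (MvPolynomial σ K) :=
  RingHom.ker (eval x)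

theorem mem_vanishingIdealAt {x : σ → K} {G : MvPolynomial σ K} :
    G ∈ vanishingIdealAt x ↔ eval x G = 0 :=
  RingHom.mem_ker

instance (x : σ → K) : (vanishingIdealAt x).IsMaximal :=
  RingHom.ker_isMaximal_of_surjective _ fun r => ⟨C r, eval_C r⟩

/-- The dilation `G ↦ G(x + ε (X - x))`, with `ε` the polynomial variable. -/
noncomputable def dilation (x : σ → K) :
    MvPolynomial σ K →ₐ[K] Polynomial (MvPolynomial σ K) :=
  aeval fun i => Polynomial.C (C (x i)) + Polynomial.X * Polynomial.C (X i - C (x i))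

theorem dilation_X (x : σ → K) (i : σ) :
    dilation x (X i) = Polynomial.C (C (x i)) + Polynomial.X * Polynomial.C (X i - C (x i)) :=
  aeval_X _ i

theorem dilation_C (x : σ → K) (r : K) : dilation x (C r) = Polynomial.C (C r) :=
  algHom_C _ r

/-- The dilation of each variable lies in the Rees algebra of the ideal of `x`, hence so does every
dilation. The coefficients are the Taylor terms of `G` at `x`. -/
theorem dilation_coeff_mem (x : σ → K) (G : MvPolynomial σ K) (i : ℕ) :
    (dilation x G).coeff i ∈ vanishingIdealAt x ^ i := by
  suffices h : dilation x G ∈ reesAlgebra (vanishingIdealAt x) from h i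
  induction G using MvPolynomial.induction_on with
  | C r =>
    rw [dilation_C]
    exact (reesAlgebra (vanishingIdealAt x)).algebraMap_mem (C r)
  | add p q hp hq => rw [map_add]; exact add_mem hp hq
  | mul_X p i hp =>
    rw [map_mul, dilation_X]
    refine mul_mem hp (add_mem ((reesAlgebra (vanishingIdealAt x)).algebraMap_mem (C (x i))) ?_)
    rw [mul_comm, ← pow_one Polynomial.X, Polynomial.C_mul_X_pow_eq_monomial]
    refine reesAlgebra.monomial_mem.2 ?_
    rw [pow_one, mem_vanishingIdealAt]
    simp

theorem eval_one_dilation (x : σ → K) (G : MvPolynomial σ K) :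
    (dilation x G).eval 1 = G := by
  induction G using MvPolynomial.induction_on with
  | C r => simp
  | add p q hp hq => rw [map_add, Polynomial.eval_add, hp, hq]
  | mul_X p i hp => rw [map_mul, dilation_X, Polynomial.eval_mul, hp]; simp

theorem dilation_coeff_zero (x : σ → K) (G : MvPolynomial σ K) :
    (dilation x G).coeff 0 = C (eval x G) := by
  induction G using MvPolynomial.induction_on with
  | C r => simp
  | add p q hp hq => rw [map_add, Polynomial.coeff_add, hp, hq]; simp
  | mul_X p i hp => rw [map_mul, dilation_X, Polynomial.mul_coeff_zero, hp]; simp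

theorem dilation_coeff_one [Fintype σ] (x : σ → K) (G : MvPolynomial σ K) :
    (dilation x G).coeff 1 = ∑ i, C (eval x (pderiv i G)) * (X i - C (x i)) := by
  classical
  induction G using MvPolynomial.induction_on with
  | C r => simp
  | add p q hp hq =>
    rw [map_add, Polynomial.coeff_add, hp, hq, ← Finset.sum_add_distrib]
    simp [add_mul]
  | mul_X p j hp =>
    have h : (dilation x (p * X j)).coeff 1
        = (dilation x p).coeff 1 * C (x j) + (dilation x p).coeff 0 * (X j - C (x j)) := by
      rw [map_mul, dilation_X, mul_add, Polynomial.coeff_add, Polynomial.coeff_mul_C,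
        ← mul_assoc, Polynomial.coeff_mul_C, Polynomial.coeff_mul_X]
    rw [h, hp, dilation_coeff_zero, Finset.sum_mul]
    have : ∀ i, C (eval x (pderiv i (p * X j))) * (X i - C (x i))
        = C (eval x (pderiv i p)) * (X i - C (x i)) * C (x j)
          + if i = j then C (eval x p) * (X j - C (x j)) else 0 := by
      intro i
      split_ifs with hij
      · subst hij; simp; ring
      · simp [pderiv_X_of_ne (Ne.symm hij)]; ring
    simp_rw [this]
    rw [Finset.sum_add_distrib]
    simp

/-- The dilation sends the ideal of `x` into the multiples of `ε`; conversely `G` is the sum of its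
Taylor terms. Orders of vanishing thus become powers of the prime `ε`. -/
theorem mem_vanishingIdealAt_pow_iff {x : σ → K} {G : MvPolynomial σ K} {k : ℕ} :
    G ∈ vanishingIdealAt x ^ k ↔ Polynomial.X ^ k ∣ dilation x G := by
  constructor
  · intro h
    have hle : vanishingIdealAt x
        ≤ (Ideal.span {Polynomial.X}).comap (dilation x).toRingHom := by
      intro H hH
      rw [Ideal.mem_comap, Ideal.mem_span_singleton]
      refine Polynomial.X_dvd_iff.2 ?_
      rw [mem_vanishingIdealAt] at hH
      exact (dilation_coeff_zero x H).trans (by rw [hH, C_0])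
    have := Ideal.le_comap_pow _ k (Ideal.pow_right_mono hle k h)
    rwa [Ideal.mem_comap, Ideal.span_singleton_pow, Ideal.mem_span_singleton] at this
  · intro h
    rw [← eval_one_dilation x G, Polynomial.eval_eq_sum_range]
    refine sum_mem fun i _ => ?_
    rw [one_pow, mul_one]
    rcases lt_or_ge i k with hik | hik
    · rw [Polynomial.X_pow_dvd_iff.1 h i hik]
      exact zero_mem _
    · exact Ideal.pow_le_pow_right hik (dilation_coeff_mem x G i)

theorem sub_dilation_coeff_mem {x : σ → K} {G : MvPolynomial σ K} {k : ℕ}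
    (h : G ∈ vanishingIdealAt x ^ k) :
    G - (dilation x G).coeff k ∈ vanishingIdealAt x ^ (k + 1) := by
  rw [mem_vanishingIdealAt_pow_iff] at h
  have h2 : G = ∑ i ∈ Finset.range ((dilation x G).natDegree + 1), (dilation x G).coeff i := by
    conv_lhs => rw [← eval_one_dilation x G, Polynomial.eval_eq_sum_range]
    simp
  have h3 : (dilation x G).coeff k = ∑ i ∈ Finset.range ((dilation x G).natDegree + 1),
      if i = k then (dilation x G).coeff i else 0 := by
    rw [Finset.sum_ite_eq']
    split_ifs with hk
    · rfl
    · exact Polynomial.coeff_eq_zero_of_natDegree_lt (by simpa using hk)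
  have h4 : G - (dilation x G).coeff k = ∑ i ∈ Finset.range ((dilation x G).natDegree + 1),
      ((dilation x G).coeff i - if i = k then (dilation x G).coeff i else 0) := by
    rw [Finset.sum_sub_distrib, ← h2, ← h3]
  rw [h4]
  refine sum_mem fun i _ => ?_
  rcases lt_trichotomy i k with hik | hik | hik
  · simp [hik.ne, Polynomial.X_pow_dvd_iff.1 h i hik]
  · simp [hik]
  · simpa [hik.ne'] using Ideal.pow_le_pow_right hik (dilation_coeff_mem x G i)

theorem eval_pderiv_eq_zero {x : σ → K} {G : MvPolynomial σ K}
    (h : G ∈ vanishingIdealAt x ^ 2) (i : σ) : eval x (pderiv i G) = 0 := by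
  rw [pow_two] at h
  refine Submodule.mul_induction_on h (fun a ha b hb => ?_) fun a b ha hb => ?_
  · rw [mem_vanishingIdealAt] at ha hb
    simp [Derivation.leibniz, ha, hb]
  · simp [ha, hb]

/-- Since `ε` is prime, orders add, and `F` has order at most one. Truncated subtraction is harmless
at `k = 0`. -/
theorem mem_pow_pred_of_mul_mem {x : σ → K} {F u : MvPolynomial σ K} {k : ℕ}
    (hF : F ∉ vanishingIdealAt x ^ 2) (h : u * F ∈ vanishingIdealAt x ^ k) :
    u ∈ vanishingIdealAt x ^ (k - 1) := by
  rcases k with _ | k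
  · simp
  rw [mem_vanishingIdealAt_pow_iff] at h hF ⊢
  rw [map_mul] at h
  have hX : Prime (Polynomial.X : Polynomial (MvPolynomial σ K)) := Polynomial.prime_X
  rw [Nat.add_sub_cancel]
  by_cases hd : Polynomial.X ∣ dilation x F
  · obtain ⟨Q, hQ⟩ := hd
    rw [hQ] at h hF
    refine hX.pow_dvd_of_dvd_mul_right k (b := Q) (fun hXQ => hF ?_) ?_
    · rw [pow_two]
      exact mul_dvd_mul_left _ hXQ
    · rw [pow_succ', mul_left_comm] at h
      exact (mul_dvd_mul_iff_left hX.ne_zero).1 h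
  · exact (pow_dvd_pow _ k.le_succ).trans (hX.pow_dvd_of_dvd_mul_right _ hd h)

theorem coeff_add_mul_of_X_pow_dvd {R : Type*} [CommRing R] {P Q : Polynomial R} {i j : ℕ}
    (hP : Polynomial.X ^ i ∣ P) (hQ : Polynomial.X ^ j ∣ Q) :
    (P * Q).coeff (i + j) = P.coeff i * Q.coeff j := by
  obtain ⟨P, rfl⟩ := hP
  obtain ⟨Q, rfl⟩ := hQ
  have : Polynomial.X ^ i * P * (Polynomial.X ^ j * Q) = P * Q * Polynomial.X ^ (i + j) := by ring
  rw [this, mul_comm (Polynomial.X ^ i) P, mul_comm (Polynomial.X ^ j) Q]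
  simp [Polynomial.coeff_mul_X_pow']

/-- The linear Taylor term has total degree one and a unit among its coefficients, so it is
irreducible, hence prime by unique factorisation. -/
theorem prime_dilation_coeff_one [Fintype σ] {x : σ → K} {F : MvPolynomial σ K} {i : σ}
    (hi : eval x (pderiv i F) ≠ 0) : Prime ((dilation x F).coeff 1) := by
  classical
  have h0 : (0 : σ →₀ ℕ) ≠ Finsupp.single i 1 := fun h =>
    one_ne_zero (Finsupp.single_eq_zero.1 h.symm)
  have hc : coeff (Finsupp.single i 1) ((dilation x F).coeff 1) = eval x (pderiv i F) := by
    rw [dilation_coeff_one, coeff_sum, Finset.sum_eq_single i]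
    · simp [coeff_C_mul, coeff_C, h0]
    · intro j _ hji
      simp [coeff_C_mul, coeff_C, MvPolynomial.coeff_X, Finsupp.single_left_inj, hji, h0]
    · simp
  refine (irreducible_of_totalDegree_eq_one (le_antisymm ?_ ?_) fun r hr => ?_).prime
  · rw [dilation_coeff_one]
    refine totalDegree_finsetSum_le fun j _ => ?_
    refine (totalDegree_mul _ _).trans ?_
    rw [totalDegree_C, zero_add]
    exact (totalDegree_sub_C_le _ _).trans (totalDegree_X j).le
  · have := le_totalDegree (mem_support_iff.2 (hc.trans_ne hi))
    simpa using this
  · have := hr (Finsupp.single i 1)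
    rw [hc] at this
    exact isUnit_of_dvd_unit this hi.isUnit

/-- In the associated graded ring of the local ring of a hypersurface at a regular point, the
product of nonzero classes is nonzero. -/
theorem mul_notMem_span_sup_pow [Fintype σ] {x : σ → K} {F G H : MvPolynomial σ K} {k : σ}
    (hF : eval x F = 0) (hk : eval x (pderiv k F) ≠ 0) {i j : ℕ}
    (hG : G ∈ Ideal.span {F} ⊔ vanishingIdealAt x ^ i)
    (hG' : G ∉ Ideal.span {F} ⊔ vanishingIdealAt x ^ (i + 1))
    (hH : H ∈ Ideal.span {F} ⊔ vanishingIdealAt x ^ j)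
    (hH' : H ∉ Ideal.span {F} ⊔ vanishingIdealAt x ^ (j + 1)) :
    G * H ∉ Ideal.span {F} ⊔ vanishingIdealAt x ^ (i + j + 1) := by
  have hF2 : F ∉ vanishingIdealAt x ^ 2 := fun h => hk (eval_pderiv_eq_zero h k)
  have hF1 : F ∈ vanishingIdealAt x ^ 1 := by rwa [pow_one, mem_vanishingIdealAt]
  set l := (dilation x F).coeff 1 with hl
  have hl2 : l ∉ vanishingIdealAt x ^ 2 := fun h =>
    hF2 (by simpa [hl] using add_mem (sub_dilation_coeff_mem hF1) h)
  -- a form of order `n` whose lowest term is divisible by `l` may be moved up modulo `F`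
  have key : ∀ (n : ℕ) (g : MvPolynomial σ K), g ∈ vanishingIdealAt x ^ n →
      l ∣ (dilation x g).coeff n → g ∈ Ideal.span {F} ⊔ vanishingIdealAt x ^ (n + 1) := by
    rintro n g hg ⟨w, hw⟩
    have hw' : w ∈ vanishingIdealAt x ^ (n - 1) := by
      apply mem_pow_pred_of_mul_mem hl2
      rw [mul_comm, ← hw]
      exact dilation_coeff_mem x g n
    -- Replacing `l` by `F` costs `w * (F - l)`, of order at least `(n - 1) + 2 ≥ n + 1`, also for
    -- `n = 0`.
    have e : g = w * F + ((g - (dilation x g).coeff n) - w * (F - l)) := by rw [hw]; ring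
    rw [e]
    refine Ideal.add_mem _ (Ideal.mem_sup_left ?_) (Ideal.mem_sup_right (sub_mem ?_ ?_))
    · exact Ideal.mul_mem_left _ _ (Ideal.mem_span_singleton_self F)
    · exact sub_dilation_coeff_mem hg
    · have := Ideal.mul_mem_mul hw' (sub_dilation_coeff_mem hF1)
      rw [← pow_add] at this
      exact Ideal.pow_le_pow_right (by omega) this
  rw [Submodule.mem_sup] at hG hH
  obtain ⟨_, hu, g, hg, rfl⟩ := hG
  obtain ⟨_, hv, h, hh, rfl⟩ := hH
  rw [Ideal.add_mem_iff_right _ (Ideal.mem_sup_left hu)] at hG'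
  rw [Ideal.add_mem_iff_right _ (Ideal.mem_sup_left hv)] at hH'
  intro hcon
  rename_i f₁ f₂
  have hgh : g * h ∈ Ideal.span {F} ⊔ vanishingIdealAt x ^ (i + j + 1) := by
    have e : (f₁ + g) * (f₂ + h) = (f₁ * (f₂ + h) + g * f₂) + g * h := by ring
    rw [e, Ideal.add_mem_iff_right] at hcon
    · exact hcon
    · exact Ideal.mem_sup_left (add_mem (Ideal.mul_mem_right _ _ hu) (Ideal.mul_mem_left _ _ hv))
  obtain ⟨f, hf, e, he, hfe⟩ := Submodule.mem_sup.1 hgh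
  obtain ⟨u, rfl⟩ := Ideal.mem_span_singleton'.1 hf
  -- Compare the Taylor terms of degree `i + j` in `g h = u F + e`: `e` contributes nothing and the
  -- term of `u F` is a multiple of `l`.
  have hdvd : l ∣ (dilation x g).coeff i * (dilation x h).coeff j := by
    rw [← coeff_add_mul_of_X_pow_dvd (mem_vanishingIdealAt_pow_iff.1 hg)
      (mem_vanishingIdealAt_pow_iff.1 hh), ← map_mul, ← hfe, map_add, Polynomial.coeff_add,
      Polynomial.X_pow_dvd_iff.1 (mem_vanishingIdealAt_pow_iff.1 he) _ (Nat.lt_succ_self _),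
      add_zero]
    have huF : u * F ∈ vanishingIdealAt x ^ (i + j) := by
      rw [eq_sub_of_add_eq hfe, pow_add]
      refine sub_mem (Ideal.mul_mem_mul hg hh) ?_
      rw [← pow_add]
      exact Ideal.pow_le_pow_right (Nat.le_succ _) he
    rcases Nat.eq_zero_or_pos (i + j) with h0 | h0
    · rw [h0, dilation_coeff_zero]
      simp [hF]
    · have e : i + j = (i + j - 1) + 1 := by omega
      rw [e, map_mul, coeff_add_mul_of_X_pow_dvd
        (mem_vanishingIdealAt_pow_iff.1 (mem_pow_pred_of_mul_mem hF2 huF))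
        (mem_vanishingIdealAt_pow_iff.1 hF1)]
      exact dvd_mul_left _ _
  rcases (prime_dilation_coeff_one hk).dvd_or_dvd hdvd with h1 | h1
  · exact hG' (key i g hg h1)
  · exact hH' (key j h hh h1)

end Dilation

/-! ### Intersection multiplicities at regular points -/

section Multiplicity

variable {F : MvPolynomial (Fin 3) ℝ}

/-- The ideals decrease as the exponent grows, so the supremum detects membership at each finite
level. -/
theorem coe_le_intersectionMultiplicity_iff {G : MvPolynomial (Fin 3) ℝ} {x : RegularPoint F}
    {k : ℕ} : (k : ℕ∞) ≤ intersectionMultiplicity F G x ↔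
      G ∈ Ideal.span {F} ⊔ vanishingIdealAt x.1.rep ^ k := by
  constructor
  · intro h
    by_contra hG
    have hk : k ≠ 0 := by
      rintro rfl
      simp at hG
    have hle : intersectionMultiplicity F G x ≤ ((k - 1 : ℕ) : ℕ∞) := by
      refine iSup₂_le fun m hm => Nat.cast_le.2 ?_
      by_contra hlt
      have hkm : k ≤ m := by omega
      exact hG ((sup_le_sup_left (Ideal.pow_le_pow_right hkm) _ :
        Ideal.span {F} ⊔ vanishingIdealAt x.1.rep ^ m ≤ _) hm)
    have := Nat.cast_le.1 (h.trans hle)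
    omega
  · exact fun h => le_iSup₂ (f := fun (m : ℕ) (_ : G ∈ Ideal.span {F} ⊔ pointIdeal x.1 ^ m) =>
      (m : ℕ∞)) k h

theorem intersectionMultiplicity_eq_coe_iff {G : MvPolynomial (Fin 3) ℝ} {x : RegularPoint F}
    {k : ℕ} : intersectionMultiplicity F G x = k ↔
      G ∈ Ideal.span {F} ⊔ vanishingIdealAt x.1.rep ^ k ∧
      G ∉ Ideal.span {F} ⊔ vanishingIdealAt x.1.rep ^ (k + 1) := by
  rw [← coe_le_intersectionMultiplicity_iff, ← coe_le_intersectionMultiplicity_iff, not_le,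
    le_antisymm_iff, and_comm, Nat.cast_succ]
  refine and_congr_right fun _ => ?_
  exact (ENat.lt_add_one_iff (ENat.natCast_ne_top k)).symm

theorem eval_rep_eq_zero (x : RegularPoint F) : eval x.1.rep F = 0 := x.2.1

theorem span_le_vanishingIdealAt (x : RegularPoint F) :
    Ideal.span {F} ≤ vanishingIdealAt x.1.rep := by
  rw [Ideal.span_singleton_le_iff_mem, mem_vanishingIdealAt]
  exact eval_rep_eq_zero x

theorem one_le_intersectionMultiplicity_iff {G : MvPolynomial (Fin 3) ℝ} {x : RegularPoint F} :
    1 ≤ intersectionMultiplicity F G x ↔ eval x.1.rep G = 0 := by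
  rw [← Nat.cast_one, coe_le_intersectionMultiplicity_iff, pow_one,
    sup_eq_right.2 (span_le_vanishingIdealAt x), mem_vanishingIdealAt]

theorem intersectionMultiplicity_eq_zero_iff {G : MvPolynomial (Fin 3) ℝ} {x : RegularPoint F} :
    intersectionMultiplicity F G x = 0 ↔ eval x.1.rep G ≠ 0 := by
  rw [Ne, ← one_le_intersectionMultiplicity_iff, Order.one_le_iff_ne_zero, not_not]

/-- For finite values the lower bound is multiplication of ideals and the upper bound is
`mul_notMem_span_sup_pow`. An infinite value is inherited by every multiple. -/
theorem intersectionMultiplicity_mul (G H : MvPolynomial (Fin 3) ℝ) (x : RegularPoint F) :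
    intersectionMultiplicity F (G * H) x =
      intersectionMultiplicity F G x + intersectionMultiplicity F H x := by
  have top : ∀ {A B : MvPolynomial (Fin 3) ℝ}, intersectionMultiplicity F A x = ⊤ →
      intersectionMultiplicity F (A * B) x = ⊤ := by
    intro A B hA
    refine ENat.eq_top_iff_forall_ge.2 fun k => ?_
    rw [coe_le_intersectionMultiplicity_iff]
    refine Ideal.mul_mem_right _ _ ?_
    rw [← coe_le_intersectionMultiplicity_iff, hA]
    exact le_top
  by_cases hG : intersectionMultiplicity F G x = ⊤
  · rw [top hG, hG, top_add]
  by_cases hH : intersectionMultiplicity F H x = ⊤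
  · rw [mul_comm, top hH, hH, add_top]
  obtain ⟨i, hi⟩ := ENat.ne_top_iff_exists.1 hG
  obtain ⟨j, hj⟩ := ENat.ne_top_iff_exists.1 hH
  rw [← hi, ← hj, ← Nat.cast_add, intersectionMultiplicity_eq_coe_iff]
  obtain ⟨hG1, hG2⟩ := intersectionMultiplicity_eq_coe_iff.1 hi.symm
  obtain ⟨hH1, hH2⟩ := intersectionMultiplicity_eq_coe_iff.1 hj.symm
  obtain ⟨k, hk⟩ := x.2.2
  refine ⟨?_, mul_notMem_span_sup_pow (eval_rep_eq_zero x) hk hG1 hG2 hH1 hH2⟩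
  obtain ⟨f, hf, g, hg, rfl⟩ := Submodule.mem_sup.1 hG1
  obtain ⟨f', hf', g', hg', rfl⟩ := Submodule.mem_sup.1 hH1
  have e : (f + g) * (f' + g') = (f * (f' + g') + g * f') + g * g' := by ring
  rw [e, pow_add]
  exact add_mem (Ideal.mem_sup_left
    (add_mem (Ideal.mul_mem_right _ _ hf) (Ideal.mul_mem_left _ _ hf')))
    (Ideal.mem_sup_right (Ideal.mul_mem_mul hg hg'))

theorem intersectionMultiplicity_sub_mul (G H : MvPolynomial (Fin 3) ℝ) (x : RegularPoint F) :
    intersectionMultiplicity F (G - H * F) x = intersectionMultiplicity F G x := by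
  refine ENat.eq_of_forall_natCast_le_iff fun k => ?_
  rw [coe_le_intersectionMultiplicity_iff, coe_le_intersectionMultiplicity_iff]
  rw [sub_eq_add_neg]
  exact Ideal.add_mem_iff_left _ (neg_mem (Ideal.mem_sup_left
    (Ideal.mul_mem_left _ _ (Ideal.mem_span_singleton_self F))))

theorem intersectionMultiplicity_C_mul {r : ℝ} (hr : r ≠ 0) (G : MvPolynomial (Fin 3) ℝ)
    (x : RegularPoint F) :
    intersectionMultiplicity F (C r * G) x = intersectionMultiplicity F G x := by
  rw [intersectionMultiplicity_mul, intersectionMultiplicity_eq_zero_iff.2 (by simpa), zero_add]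

/-- If `G` meets the curve `F = 0` with multiplicity at least two, the gradients are parallel. -/
theorem exists_eval_pderiv_eq {G : MvPolynomial (Fin 3) ℝ} {x : RegularPoint F}
    (h : 2 ≤ intersectionMultiplicity F G x) :
    ∃ c, ∀ i, eval x.1.rep (pderiv i G) = c * eval x.1.rep (pderiv i F) := by
  have h' : ((2 : ℕ) : ℕ∞) ≤ intersectionMultiplicity F G x := h
  rw [coe_le_intersectionMultiplicity_iff] at h'
  obtain ⟨f, hf, e, he, rfl⟩ := Submodule.mem_sup.1 h'
  obtain ⟨u, rfl⟩ := Ideal.mem_span_singleton'.1 hf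
  refine ⟨eval x.1.rep u, fun i => ?_⟩
  simp [Derivation.leibniz, eval_pderiv_eq_zero he, eval_rep_eq_zero x]

/-- Polynomials that do not vanish at `x` are units modulo powers of the ideal of `x`. -/
theorem mem_of_mul_mem_of_eval_ne_zero {σ K : Type*} [Field K] {x : σ → K} {m : ℕ}
    {J : Ideal (MvPolynomial σ K)} (hJ : vanishingIdealAt x ^ m ≤ J) {A B : MvPolynomial σ K}
    (hA : eval x A ≠ 0) (h : A * B ∈ J) : B ∈ J := by
  -- The ideal of `x` is maximal and misses `A`, so it is comaximal with `(A)`, and so are its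
  -- powers.
  have hco : Ideal.span {A} ⊔ vanishingIdealAt x ^ m = ⊤ := by
    apply Ideal.sup_pow_eq_top
    rw [sup_comm]
    by_contra hne
    have := Ideal.IsMaximal.eq_of_le (inferInstanceAs (vanishingIdealAt x).IsMaximal) hne
      le_sup_left
    refine hA (mem_vanishingIdealAt.1 ?_)
    rw [this]
    exact Ideal.mem_sup_right (Ideal.mem_span_singleton_self A)
  obtain ⟨_, hr, s, hs, hrs⟩ := Submodule.mem_sup.1 ((Ideal.eq_top_iff_one _).1 hco)
  obtain ⟨r, rfl⟩ := Ideal.mem_span_singleton'.1 hr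
  have e : B = r * (A * B) + s * B := by
    rw [← mul_assoc, ← add_mul, hrs, one_mul]
  rw [e]
  exact add_mem (Ideal.mul_mem_left _ _ h) (Ideal.mul_mem_right _ _ (hJ hs))

end Multiplicity

/-! ### The line at infinity -/

section LineAtInfinity

variable {F : MvPolynomial (Fin 3) ℝ}

theorem IsIrreducibleCircularCubic.identityPoint_rep_two
    (hF : IsIrreducibleCircularCubic F) : (identityPoint hF).1.rep 2 = 0 :=
  hF.existsUnique_atInfinity.choose_spec.1.2

theorem IsIrreducibleCircularCubic.eq_identityPoint
    (hF : IsIrreducibleCircularCubic F) {x : RegularPoint F} (hx : x.1.rep 2 = 0) :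
    x = identityPoint hF :=
  Subtype.ext (hF.existsUnique_atInfinity.choose_spec.2 x.1 ⟨x.2.1, hx⟩)

open Classical in
-- Multiplicity two at `o` would make the gradient of `F` parallel to that of `z`, so its first two
-- entries would vanish. There `u x + v y = 0`, so these entries are `u (x² + y²)` and `v (x² +
-- y²)`, forcing `u = v = 0`.
theorem IsIrreducibleCircularCubic.intersectsExactlyIn_X_two
    (hF : IsIrreducibleCircularCubic F) :
    IntersectsExactlyIn F (X 2) {identityPoint hF} := by
  refine ⟨fun p hp hz => hF.isRegularPoint_of_atInfinity hp (by simpa [OnCurve] using hz),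
    fun x => ?_⟩
  rw [Multiset.count_singleton]
  split_ifs with hx
  · subst hx
    have h1 : 1 ≤ intersectionMultiplicity F (X 2) (identityPoint hF) :=
      one_le_intersectionMultiplicity_iff.2 (by simpa using hF.identityPoint_rep_two)
    refine le_antisymm ?_ (by simpa using h1)
    by_contra hlt
    have h2 : 2 ≤ intersectionMultiplicity F (X 2) (identityPoint hF) := by
      rw [not_le] at hlt
      simpa [one_add_one_eq_two] using Order.add_one_le_of_lt hlt
    obtain ⟨c, hc⟩ := exists_eval_pderiv_eq h2
    have hc0 : c ≠ 0 := by
      rintro rfl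
      simpa using hc 2
    have d0 : eval (identityPoint hF).1.rep (pderiv 0 F) = 0 := by
      simpa [pderiv_X_of_ne, hc0] using (hc 0).symm
    have d1 : eval (identityPoint hF).1.rep (pderiv 1 F) = 0 := by
      simpa [pderiv_X_of_ne, hc0] using (hc 1).symm
    obtain ⟨G, u, v, huv, h⟩ := hF.exists_eq
    have hz := hF.identityPoint_rep_two
    have hp := eval_rep_eq_zero (identityPoint hF)
    have hne := (identityPoint hF).1.rep_nonzero
    revert d0 d1 hz hp hne
    generalize (identityPoint hF).1.rep = y
    intro d0 d1 hz hp hne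
    rw [h] at hp d0 d1
    simp [hz, pderiv_X] at hp d0 d1
    have hxy : y 0 ^ 2 + y 1 ^ 2 ≠ 0 := by
      intro h0
      apply hne
      funext i
      have h1 : y 0 = 0 := by nlinarith [sq_nonneg (y 0), sq_nonneg (y 1)]
      have h2 : y 1 = 0 := by nlinarith [sq_nonneg (y 0), sq_nonneg (y 1)]
      fin_cases i <;> simp [h1, h2, hz]
    have hl : u * y 0 + v * y 1 = 0 := hp.resolve_right hxy
    rw [hl] at d0 d1
    simp [hxy] at d0 d1
    simp [d0, d1] at huv
  · rw [Nat.cast_zero, intersectionMultiplicity_eq_zero_iff]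
    exact fun h => hx (hF.eq_identityPoint (by simpa using h))

end LineAtInfinity

/-! ### Linear forms and homogeneity -/

section LinearForm

/-- The linear form with coefficient vector `w`. -/
noncomputable def linearForm (w : Fin 3 → ℝ) : MvPolynomial (Fin 3) ℝ := ∑ i, C (w i) * X i

theorem eval_linearForm (w y : Fin 3 → ℝ) : eval y (linearForm w) = w ⬝ᵥ y := by
  simp [linearForm, dotProduct]

theorem isHomogeneous_linearForm (w : Fin 3 → ℝ) : (linearForm w).IsHomogeneous 1 :=
  IsHomogeneous.sum _ _ _ fun _ _ => isHomogeneous_C_mul_X _ _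

theorem linearForm_zero : linearForm 0 = 0 := by simp [linearForm]

theorem linearForm_smul (c : ℝ) (w : Fin 3 → ℝ) : linearForm (c • w) = C c * linearForm w := by
  simp [linearForm, Finset.mul_sum, mul_assoc]

theorem eval_pderiv_linearForm (w y : Fin 3 → ℝ) (i : Fin 3) :
    eval y (pderiv i (linearForm w)) = w i := by
  simp only [linearForm, map_sum, Derivation.leibniz, pderiv_C]
  rw [Finset.sum_eq_single i]
  · simp
  · intro j _ hj
    simp [pderiv_X_of_ne hj]
  · simp

theorem linearForm_ne_zero {w : Fin 3 → ℝ} (hw : w ≠ 0) : linearForm w ≠ 0 := by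
  intro h
  refine hw (funext fun i => ?_)
  rw [← eval_pderiv_linearForm w 0 i, h]
  simp

theorem exists_eq_linearForm {L : MvPolynomial (Fin 3) ℝ} (hL : L.IsHomogeneous 1) :
    ∃ w, L = linearForm w := by
  refine ⟨fun i => coeff (Finsupp.single i 1) L, ?_⟩
  have h := hL
  rw [← mem_homogeneousSubmodule, homogeneousSubmodule_one_eq_span_X] at h
  obtain ⟨c, rfl⟩ := (Submodule.mem_span_range_iff_exists_fun ℝ).1 h
  rw [linearForm]
  refine Finset.sum_congr rfl fun i _ => ?_
  rw [smul_eq_C_mul]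
  congr 2
  rw [coeff_sum, Finset.sum_eq_single i]
  · simp
  · intro j _ hj
    simp [MvPolynomial.coeff_X, Finsupp.single_left_inj, hj]
  · simp

/-- A polynomial that vanishes on the plane `w · y = 0` is divisible by the linear form `w`. -/
theorem linearForm_dvd {w : Fin 3 → ℝ} (hw : w ≠ 0) {G : MvPolynomial (Fin 3) ℝ}
    (h : ∀ y, w ⬝ᵥ y = 0 → eval y G = 0) : linearForm w ∣ G := by
  obtain ⟨i, hi⟩ := Function.ne_iff.1 hw
  rw [Pi.zero_apply] at hi
  -- Substituting `g` projects onto the plane `w · y = 0` along the `i`-th axis, which kills `G`.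
  -- Modulo the linear form the substitution is the identity.
  set g : Fin 3 → MvPolynomial (Fin 3) ℝ :=
    fun j => X j - linearForm w * C ((w i)⁻¹ * (Pi.single i 1 : Fin 3 → ℝ) j) with hg
  have h0 : aeval g G = 0 := by
    refine MvPolynomial.funext fun y => ?_
    have e : eval y (aeval g G) = eval (fun j => eval y (g j)) G := by
      have : (aeval y).comp (aeval g) = aeval (fun j => eval y (g j)) := by
        ext j
        simp
      simpa using congrArg (fun f => f G) this
    have e' : (fun j => eval y (g j)) = y - ((w ⬝ᵥ y) * (w i)⁻¹) • Pi.single i 1 := by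
      ext j
      simp only [hg, map_sub, map_mul, eval_X, eval_C, eval_linearForm, Pi.sub_apply,
        Pi.smul_apply, smul_eq_mul]
      ring
    rw [e, map_zero, e']
    refine h _ ?_
    rw [dotProduct_sub, dotProduct_smul, dotProduct_single_one, smul_eq_mul,
      inv_mul_cancel_right₀ hi, sub_self]
  rw [← Ideal.mem_span_singleton, ← Ideal.Quotient.eq_zero_iff_mem]
  have e : ∀ P, Ideal.Quotient.mkₐ ℝ (Ideal.span {linearForm w}) P
      = Ideal.Quotient.mkₐ ℝ (Ideal.span {linearForm w}) (aeval g P) := by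
    intro P
    rw [← AlgHom.comp_apply]
    congr 1
    ext j
    simp [hg, Ideal.Quotient.mkₐ_eq_mk]
  have := e G
  rwa [h0, map_zero] at this

/-- Homogeneous polynomials scale, with values in any commutative algebra. -/
theorem aeval_mul_of_isHomogeneous {A : Type*} [CommRing A] [Algebra ℝ A]
    {G : MvPolynomial (Fin 3) ℝ} {d : ℕ} (hG : G.IsHomogeneous d) (k : A) (y : Fin 3 → A) :
    aeval (fun i => k * y i) G = k ^ d * aeval y G := by
  rw [aeval_def, aeval_def, eval₂_eq, eval₂_eq, Finset.mul_sum]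
  refine Finset.sum_congr rfl fun s hs => ?_
  have hd : d = ∑ i ∈ s.support, s i := hG.degree_eq_sum_deg_support hs
  simp only [mul_pow, Finset.prod_mul_distrib]
  rw [Finset.prod_pow_eq_pow_sum, ← hd]
  ring

theorem eval_smul_of_isHomogeneous {G : MvPolynomial (Fin 3) ℝ} {d : ℕ} (hG : G.IsHomogeneous d)
    (k : ℝ) (y : Fin 3 → ℝ) : eval (k • y) G = k ^ d * eval y G := by
  exact aeval_mul_of_isHomogeneous hG k y

end LinearForm

/-! ### Restriction of forms to a parametrised line -/

section LineRestriction

/-- Restriction of polynomials to the affine line `t ↦ u + t v`. -/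
noncomputable def lineRestriction (u v : Fin 3 → ℝ) :
    MvPolynomial (Fin 3) ℝ →ₐ[ℝ] Polynomial ℝ :=
  aeval fun i => Polynomial.C (u i) + Polynomial.X * Polynomial.C (v i)

theorem eval_lineRestriction (u v : Fin 3 → ℝ) (t : ℝ) (G : MvPolynomial (Fin 3) ℝ) :
    (lineRestriction u v G).eval t = eval (u + t • v) G := by
  have : (Polynomial.aeval t).comp (lineRestriction u v) = aeval (u + t • v) := by
    ext i
    simp [lineRestriction, mul_comm t]
  simpa using congrArg (fun f => f G) this

theorem lineRestriction_linearForm {u v w : Fin 3 → ℝ} (hu : w ⬝ᵥ u = 0) (hv : w ⬝ᵥ v = 0) :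
    lineRestriction u v (linearForm w) = 0 := by
  refine Polynomial.funext fun t => ?_
  rw [eval_lineRestriction, eval_linearForm]
  simp [hu, hv]

/-- The point `v` is the one missed by `t ↦ u + t v`; the coefficient at `d` records the value
there, and may vanish. -/
theorem lineRestriction_natDegree_le_and_coeff (u v : Fin 3 → ℝ) {G : MvPolynomial (Fin 3) ℝ}
    {d : ℕ} (hG : G.IsHomogeneous d) :
    (lineRestriction u v G).natDegree ≤ d ∧ (lineRestriction u v G).coeff d = eval v G := by
  have hlin : ∀ i, (Polynomial.C (u i) + Polynomial.X * Polynomial.C (v i)).natDegree ≤ 1 := by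
    intro i
    compute_degree
  have hcoeff : ∀ i, (Polynomial.C (u i) + Polynomial.X * Polynomial.C (v i)).coeff 1 = v i := by
    intro i
    simp [Polynomial.coeff_C]
  rw [lineRestriction, aeval_def, eval₂_eq, eval_eq]
  have hterm : ∀ s ∈ G.support, (∏ i ∈ s.support,
      (Polynomial.C (u i) + Polynomial.X * Polynomial.C (v i)) ^ s i).natDegree ≤ d ∧
      (∏ i ∈ s.support,
        (Polynomial.C (u i) + Polynomial.X * Polynomial.C (v i)) ^ s i).coeff d
        = ∏ i ∈ s.support, v i ^ s i := by
    intro s hs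
    have hd : ∑ i ∈ s.support, s i = d := (hG.degree_eq_sum_deg_support hs).symm
    rw [← hd]
    generalize s.support = S
    clear hd hs
    induction S using Finset.induction_on with
    | empty => simp
    | insert i S hi ih =>
      have h1 : ((Polynomial.C (u i) + Polynomial.X * Polynomial.C (v i)) ^ s i).natDegree
          ≤ s i := by
        simpa using Polynomial.natDegree_pow_le_of_le (s i) (hlin i)
      rw [Finset.prod_insert hi, Finset.prod_insert hi, Finset.sum_insert hi]
      refine ⟨Polynomial.natDegree_mul_le_of_le h1 ih.1, ?_⟩
      rw [Polynomial.coeff_mul_add_eq_of_natDegree_le h1 ih.1, ih.2]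
      have := Polynomial.coeff_pow_of_natDegree_le (m := s i) (hlin i)
      rw [mul_one, hcoeff] at this
      rw [this]
  constructor
  · refine Polynomial.natDegree_sum_le_of_forall_le _ _ fun s hs => ?_
    refine (Polynomial.natDegree_C_mul_le _ _).trans (hterm s hs).1
  · rw [Polynomial.finsetSum_coeff]
    refine Finset.sum_congr rfl fun s hs => ?_
    rw [← (hterm s hs).2]
    exact Polynomial.coeff_C_mul _

/-- Moving the base vector translates the parameter, and rescaling multiplies by the unit `k ^ d`.
This allows the chosen representative of a point to serve as base vector. -/
theorem X_pow_dvd_lineRestriction_iff {G : MvPolynomial (Fin 3) ℝ} {d : ℕ}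
    (hG : G.IsHomogeneous d) {u v : Fin 3 → ℝ} {k t : ℝ} (hk : k ≠ 0) (m : ℕ) :
    Polynomial.X ^ m ∣ lineRestriction (k • (u + t • v)) (k • v) G ↔
      (Polynomial.X - Polynomial.C t) ^ m ∣ lineRestriction u v G := by
  have e : lineRestriction (k • (u + t • v)) (k • v) G
      = Polynomial.C (k ^ d) * (lineRestriction u v G).comp (Polynomial.X + Polynomial.C t) := by
    refine Polynomial.funext fun s => ?_
    rw [eval_lineRestriction, Polynomial.eval_mul, Polynomial.eval_comp, eval_lineRestriction,
      Polynomial.eval_C, ← eval_smul_of_isHomogeneous hG]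
    congr 1
    congr 1
    ext i
    simp
    ring
  have hu : IsUnit (Polynomial.C (k ^ d)) :=
    Polynomial.isUnit_C.2 (pow_ne_zero _ hk).isUnit
  rw [e, hu.dvd_mul_left, Polynomial.dvd_comp_X_add_C_iff]
  simp

/-- A basis `u, v` of the plane `w · y = 0`, with the coordinate functions `a, b`. -/
structure IsPlaneBasis (w u v a b : Fin 3 → ℝ) : Prop where
  w_ne : w ≠ 0
  wu : w ⬝ᵥ u = 0
  wv : w ⬝ᵥ v = 0
  au : a ⬝ᵥ u = 1
  av : a ⬝ᵥ v = 0
  bu : b ⬝ᵥ u = 0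
  bv : b ⬝ᵥ v = 1
  span : ∀ y, w ⬝ᵥ y = 0 → y = (a ⬝ᵥ y) • u + (b ⬝ᵥ y) • v

/-- Expansion of `y` along `w × v`, `w`, `v`, cleared of its Gram determinant. It supplies plane
coordinates and shows that a vector orthogonal to two independent ones is a multiple of their cross
product. -/
theorem cross_dot_cross_smul_eq (w v y : Fin 3 → ℝ) :
    (crossProduct w v ⬝ᵥ crossProduct w v) • y
      = (crossProduct w v ⬝ᵥ y) • crossProduct w v
        + ((v ⬝ᵥ v) * (w ⬝ᵥ y) - (w ⬝ᵥ v) * (v ⬝ᵥ y)) • w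
        + ((w ⬝ᵥ w) * (v ⬝ᵥ y) - (w ⬝ᵥ v) * (w ⬝ᵥ y)) • v := by
  ext i
  simp only [Pi.add_apply, Pi.smul_apply, smul_eq_mul]
  fin_cases i <;>
  · simp [crossProduct, dotProduct, Fin.sum_univ_three]
    ring

theorem exists_isPlaneBasis {w v : Fin 3 → ℝ} (hw : w ≠ 0) (hv : v ≠ 0) (hwv : w ⬝ᵥ v = 0) :
    ∃ u a b, IsPlaneBasis w u v a b := by
  have hw2 : w ⬝ᵥ w ≠ 0 := fun h => hw (dotProduct_self_eq_zero.1 h)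
  have hv2 : v ⬝ᵥ v ≠ 0 := fun h => hv (dotProduct_self_eq_zero.1 h)
  set u := crossProduct w v with hu
  have huu : u ⬝ᵥ u = (w ⬝ᵥ w) * (v ⬝ᵥ v) := by
    rw [hu, cross_dot_cross, hwv]; ring
  have hu2 : u ⬝ᵥ u ≠ 0 := huu ▸ mul_ne_zero hw2 hv2
  have hwu : w ⬝ᵥ u = 0 := dot_self_cross w v
  have hvu : v ⬝ᵥ u = 0 := dot_cross_self w v
  refine ⟨u, (u ⬝ᵥ u)⁻¹ • u, (v ⬝ᵥ v)⁻¹ • v, hw, hwu, hwv, ?_, ?_, ?_, ?_, fun y hy => ?_⟩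
  · rw [smul_dotProduct, smul_eq_mul, inv_mul_cancel₀ hu2]
  · rw [smul_dotProduct, dotProduct_comm u v, hvu, smul_zero]
  · rw [smul_dotProduct, hvu, smul_zero]
  · rw [smul_dotProduct, smul_eq_mul, inv_mul_cancel₀ hv2]
  · have key : (u ⬝ᵥ u) • y = (u ⬝ᵥ y) • u + ((w ⬝ᵥ w) * (v ⬝ᵥ y)) • v := by
      rw [hu, cross_dot_cross_smul_eq w v y, hwv, hy]
      simp
    rw [huu] at key
    rw [smul_dotProduct, smul_dotProduct, smul_eq_mul, smul_eq_mul, huu]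
    ext i
    have := congrFun key i
    simp at this ⊢
    field_simp
    linear_combination this

theorem IsPlaneBasis.move {w u v a b : Fin 3 → ℝ} (h : IsPlaneBasis w u v a b) {k t : ℝ}
    (hk : k ≠ 0) :
    IsPlaneBasis w (k • (u + t • v)) (k • v) (k⁻¹ • a) (k⁻¹ • (b - t • a)) where
  w_ne := h.w_ne
  wu := by simp [h.wu, h.wv]
  wv := by simp [h.wv]
  au := by simp [h.au, h.av, hk]
  av := by simp [h.av]
  bu := by
    simp [h.au, h.av, h.bu, h.bv, sub_dotProduct]
    ring
  bv := by simp [h.av, h.bv, hk, sub_dotProduct]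
  span y hy := by
    conv_lhs => rw [h.span y hy]
    ext i
    simp [sub_dotProduct]
    field_simp
    ring

theorem IsPlaneBasis.linearForm_dvd_of_lineRestriction_eq_zero {w u v a b : Fin 3 → ℝ}
    (h : IsPlaneBasis w u v a b) {G : MvPolynomial (Fin 3) ℝ} {d : ℕ} (hG : G.IsHomogeneous d)
    (h0 : lineRestriction u v G = 0) : linearForm w ∣ G := by
  refine linearForm_dvd h.w_ne fun y hy => ?_
  rw [h.span y hy]
  generalize a ⬝ᵥ y = s
  generalize b ⬝ᵥ y = t
  -- Multiples of `v` are not reached by the affine line; there the coefficient of degree `d` gives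
  -- the value.
  by_cases hs : s = 0
  · rw [hs, zero_smul, zero_add, eval_smul_of_isHomogeneous hG,
      ← (lineRestriction_natDegree_le_and_coeff u v hG).2, h0]
    simp
  · have e : s • u + t • v = s • (u + (t / s) • v) := by
      ext i
      simp
      field_simp
    rw [e, eval_smul_of_isHomogeneous hG, ← eval_lineRestriction, h0]
    simp

end LineRestriction

/-! ### The multiplicity of a line as an order of vanishing along it -/

section LineMultiplicity

variable {F : MvPolynomial (Fin 3) ℝ}

/-- Modulo order `m` at `x`, `G` is a multiple of `F`, so it suffices to treat `F`. Write the linear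
form as `u F + h` with `h` of order `m`. On the line it vanishes, and `u` is nonzero at `x`, so `F`
vanishes to order `m` along the line. -/
theorem X_pow_dvd_lineRestriction_of_mem {x : RegularPoint F} {w v : Fin 3 → ℝ} (hw : w ≠ 0)
    (hwx : w ⬝ᵥ x.1.rep = 0) (hwv : w ⬝ᵥ v = 0) {m : ℕ} {G : MvPolynomial (Fin 3) ℝ}
    (hL : (m : ℕ∞) ≤ intersectionMultiplicity F (linearForm w) x)
    (hG : (m : ℕ∞) ≤ intersectionMultiplicity F G x) :
    Polynomial.X ^ m ∣ lineRestriction x.1.rep v G := by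
  have hθ : ∀ H ∈ vanishingIdealAt x.1.rep ^ m,
      Polynomial.X ^ m ∣ lineRestriction x.1.rep v H := by
    intro H hH
    have hle : vanishingIdealAt x.1.rep
        ≤ (Ideal.span {Polynomial.X}).comap (lineRestriction x.1.rep v).toRingHom := by
      intro P hP
      rw [Ideal.mem_comap, Ideal.mem_span_singleton]
      refine Polynomial.X_dvd_iff.2 ?_
      rw [Polynomial.coeff_zero_eq_eval_zero]
      refine (eval_lineRestriction _ _ _ _).trans ?_
      rw [zero_smul, add_zero, mem_vanishingIdealAt.1 hP]
    have := Ideal.le_comap_pow _ m (Ideal.pow_right_mono hle m hH)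
    rwa [Ideal.mem_comap, Ideal.span_singleton_pow, Ideal.mem_span_singleton] at this
  have hFm : Polynomial.X ^ m ∣ lineRestriction x.1.rep v F := by
    -- The gradient of `h` vanishes at `x` only once `m ≥ 2`; below that `F(x) = 0` is enough.
    rcases Nat.lt_or_ge m 2 with hm | hm
    · refine (pow_dvd_pow _ (Nat.lt_succ_iff.1 hm)).trans ?_
      rw [pow_one, Polynomial.X_dvd_iff, Polynomial.coeff_zero_eq_eval_zero, eval_lineRestriction,
        zero_smul, add_zero, eval_rep_eq_zero]
    · rw [coe_le_intersectionMultiplicity_iff] at hL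
      obtain ⟨f, hf, h, hh, hfh⟩ := Submodule.mem_sup.1 hL
      obtain ⟨u, rfl⟩ := Ideal.mem_span_singleton'.1 hf
      have hu : eval x.1.rep u ≠ 0 := by
        intro hu
        apply hw
        funext i
        have := eval_pderiv_eq_zero (Ideal.pow_le_pow_right hm hh) i
        rw [← eval_pderiv_linearForm w x.1.rep i, ← hfh]
        simp [Derivation.leibniz, this, hu, eval_rep_eq_zero x]
      have h1 : Polynomial.X ^ m ∣ lineRestriction x.1.rep v u * lineRestriction x.1.rep v F := by
        have h2 := congrArg (lineRestriction x.1.rep v) hfh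
        rw [lineRestriction_linearForm hwx hwv, map_add, map_mul] at h2
        rw [eq_neg_of_add_eq_zero_left h2]
        exact (hθ h hh).neg_right
      refine Polynomial.prime_X.pow_dvd_of_dvd_mul_left m (fun hX => hu ?_) h1
      rw [Polynomial.X_dvd_iff, Polynomial.coeff_zero_eq_eval_zero, eval_lineRestriction] at hX
      simpa using hX
  rw [coe_le_intersectionMultiplicity_iff] at hG
  obtain ⟨f, hf, h, hh, rfl⟩ := Submodule.mem_sup.1 hG
  obtain ⟨u, rfl⟩ := Ideal.mem_span_singleton'.1 hf
  rw [map_add, map_mul]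
  exact dvd_add (hFm.mul_left _) (hθ h hh)

/-- Projecting to the plane of the line gives `F = P + w H`, and `P` inherits the order `m` of the
restricted `F`. For `m ≥ 2` the gradient of `P` vanishes at `x`, so regularity gives `H(x) ≠ 0`, and
`H` can be cancelled from `H w = F - P`. -/
theorem le_intersectionMultiplicity_linearForm {d : ℕ} (hF : F.IsHomogeneous d)
    {x : RegularPoint F} {w v a b : Fin 3 → ℝ} (h : IsPlaneBasis w x.1.rep v a b) {m : ℕ}
    (hm : Polynomial.X ^ m ∣ lineRestriction x.1.rep v F) :
    (m : ℕ∞) ≤ intersectionMultiplicity F (linearForm w) x := by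
  rcases Nat.lt_or_ge m 2 with hm2 | hm2
  · refine (Nat.cast_le.2 (Nat.lt_succ_iff.1 hm2)).trans ?_
    rw [Nat.cast_one, one_le_intersectionMultiplicity_iff, eval_linearForm, h.wu]
  rw [coe_le_intersectionMultiplicity_iff]
  set p := x.1.rep with hp
  set A := linearForm a with hA
  set B := linearForm b with hB
  have hAp : eval p A = 1 := by rw [hA, eval_linearForm, h.au]
  have hBp : eval p B = 0 := by rw [hB, eval_linearForm, h.bu]
  -- the projection of `F` to the plane of the line
  set P : MvPolynomial (Fin 3) ℝ := aeval (fun i => A * C (p i) + B * C (v i)) F with hP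
  have hdvd : linearForm w ∣ F - P := by
    refine linearForm_dvd h.w_ne fun y hy => ?_
    have e : eval y P = eval ((a ⬝ᵥ y) • p + (b ⬝ᵥ y) • v) F := by
      have : (aeval y).comp (aeval fun i => A * C (p i) + B * C (v i))
          = aeval (R := ℝ) (S₁ := ℝ) ((a ⬝ᵥ y) • p + (b ⬝ᵥ y) • v) := by
        ext i
        simp [hA, hB, eval_linearForm]
      exact congrArg (fun f => f F) this
    rw [map_sub, e, ← h.span y hy, sub_self]
  have hPm : P ∈ vanishingIdealAt p ^ m := by
    have hco : ∃ A', A * A' - 1 ∈ vanishingIdealAt p ^ m := by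
      have h1 : (1 : MvPolynomial (Fin 3) ℝ) ∈ Ideal.span {A} ⊔ vanishingIdealAt p ^ m := by
        refine mem_of_mul_mem_of_eval_ne_zero (x := p) (m := m) le_sup_right
          (A := A) (by rw [hAp]; exact one_ne_zero) ?_
        rw [mul_one]
        exact Ideal.mem_sup_left (Ideal.mem_span_singleton_self A)
      obtain ⟨_, hr, s, hs, hrs⟩ := Submodule.mem_sup.1 h1
      obtain ⟨r, rfl⟩ := Ideal.mem_span_singleton'.1 hr
      refine ⟨r, ?_⟩
      rw [← hrs]
      have e : A * r - (r * A + s) = -s := by ring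
      rw [e]
      exact neg_mem hs
    obtain ⟨A', hA'⟩ := hco
    set q := Ideal.Quotient.mkₐ ℝ (vanishingIdealAt p ^ m) with hq
    have hq0 : ∀ H, q H = 0 ↔ H ∈ vanishingIdealAt p ^ m := fun H => Ideal.Quotient.eq_zero_iff_mem
    have hAA' : q A * q A' = 1 := by
      rw [← map_mul, ← sub_eq_zero, ← map_one q, ← map_sub, hq0]
      exact hA'
    -- Dehomogenisation: `P = A ^ d f(B / A)` with `f` the restricted polynomial, `A'` inverting `A`
    -- modulo the power of the ideal, and `B` vanishing at `p`.
    have e1 : q P = q A ^ d * Polynomial.aeval (q (B * A')) (lineRestriction p v F) := by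
      have e2 : Polynomial.aeval (q (B * A')) (lineRestriction p v F)
          = aeval (fun i => algebraMap ℝ _ (p i) + q (B * A') * algebraMap ℝ _ (v i)) F := by
        have : (Polynomial.aeval (q (B * A'))).comp (lineRestriction p v)
            = aeval (fun i => algebraMap ℝ _ (p i) + q (B * A') * algebraMap ℝ _ (v i)) := by
          ext i
          simp [lineRestriction, mul_comm (q B * q A')]
        exact congrArg (fun f => f F) this
      rw [e2, ← aeval_mul_of_isHomogeneous hF]
      have : q.comp (aeval fun i => A * C (p i) + B * C (v i))
          = aeval (fun i => q A * (algebraMap ℝ _ (p i) + q (B * A') * algebraMap ℝ _ (v i))) := by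
        ext i
        have hC : ∀ r : ℝ, q (C r) = algebraMap ℝ _ r := fun r => q.commutes r
        simp only [AlgHom.comp_apply, aeval_X, map_add, map_mul, hC]
        linear_combination (- q B * algebraMap ℝ _ (v i)) * hAA'
      exact congrArg (fun f => f F) this
    rw [← hq0, e1]
    obtain ⟨g, hg⟩ := hm
    rw [hg, map_mul, map_pow (Polynomial.aeval _), Polynomial.aeval_X, ← map_pow q (B * A'),
      (hq0 ((B * A') ^ m)).2, zero_mul, mul_zero]
    refine Ideal.pow_mem_pow (Ideal.mul_mem_right _ _ ?_) m
    rwa [mem_vanishingIdealAt]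
  obtain ⟨H, hH⟩ := hdvd
  have hFH : F = P + linearForm w * H := by rw [← hH]; ring
  have hHp : eval p H ≠ 0 := by
    intro h0
    obtain ⟨i, hi⟩ := x.2.2
    apply hi
    change eval p (pderiv i F) = 0
    rw [hFH]
    simp [Derivation.leibniz, h0, eval_linearForm, h.wu,
      eval_pderiv_eq_zero (Ideal.pow_le_pow_right hm2 hPm) i]
  refine mem_of_mul_mem_of_eval_ne_zero (x := p) (m := m) le_sup_right hHp ?_
  have e : H * linearForm w = F - P := by rw [hH]; ring
  rw [e]
  exact sub_mem (Ideal.mem_sup_left (Ideal.mem_span_singleton_self F)) (Ideal.mem_sup_right hPm)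

end LineMultiplicity

/-! ### Line sections, third points and the group equation -/

section ThirdPoint

variable {F : MvPolynomial (Fin 3) ℝ}

theorem derivative_lineRestriction (u v : Fin 3 → ℝ) (G : MvPolynomial (Fin 3) ℝ) :
    Polynomial.derivative (lineRestriction u v G)
      = ∑ i, lineRestriction u v (pderiv i G) * Polynomial.C (v i) := by
  induction G using MvPolynomial.induction_on with
  | C r => simp [lineRestriction]
  | add p q hp hq => simp [hp, hq, add_mul, Finset.sum_add_distrib]
  | mul_X p j hp =>
    have hX : lineRestriction u v (X j) = Polynomial.C (u j) + Polynomial.X * Polynomial.C (v j) :=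
      aeval_X _ j
    have hterm : ∀ i, lineRestriction u v (pderiv i (p * X j)) * Polynomial.C (v i)
        = lineRestriction u v (pderiv i p) * Polynomial.C (v i) * lineRestriction u v (X j)
          + if i = j then lineRestriction u v p * Polynomial.C (v j) else 0 := by
      intro i
      split_ifs with hij
      · subst hij; simp; ring
      · simp [pderiv_X_of_ne (Ne.symm hij)]; ring
    simp_rw [hterm]
    rw [Finset.sum_add_distrib, ← Finset.sum_mul, ← hp, map_mul, Polynomial.derivative_mul]
    simp [hX]

/-- The point `p` has parameter `t` on the affine line `t ↦ u + t v`. -/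
def HasParameter (u v : Fin 3 → ℝ) (p : RP2) (t : ℝ) : Prop :=
  ∃ k : ℝ, k ≠ 0 ∧ p.rep = k • (u + t • v)

theorem HasParameter.eq_iff {w u v a b : Fin 3 → ℝ} (h : IsPlaneBasis w u v a b) {p q : RP2}
    {s t : ℝ} (hp : HasParameter u v p s) (hq : HasParameter u v q t) : p = q ↔ s = t := by
  obtain ⟨k, hk, hpk⟩ := hp
  obtain ⟨l, hl, hql⟩ := hq
  constructor
  · rintro rfl
    have h1 := congrArg (a ⬝ᵥ ·) (hpk.symm.trans hql)
    have h2 := congrArg (b ⬝ᵥ ·) (hpk.symm.trans hql)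
    simp [h.au, h.av, h.bu, h.bv] at h1 h2
    subst h1
    simpa [hk] using h2
  · rintro rfl
    rw [← p.mk_rep, ← q.mk_rep, Projectivization.mk_eq_mk_iff']
    refine ⟨k * l⁻¹, ?_⟩
    rw [hpk, hql, smul_smul, inv_mul_cancel_right₀ hl]

theorem IsPlaneBasis.exists_hasParameter {w u v a b : Fin 3 → ℝ} (h : IsPlaneBasis w u v a b)
    {d : ℕ} (hF : F.IsHomogeneous d) (hv : eval v F ≠ 0) {p : RP2} (hp : OnCurve F p)
    (hw : w ⬝ᵥ p.rep = 0) : ∃ t, HasParameter u v p t := by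
  have e := h.span _ hw
  have ha : a ⬝ᵥ p.rep ≠ 0 := by
    intro ha
    rw [ha, zero_smul, zero_add] at e
    rw [OnCurve, e, eval_smul_of_isHomogeneous hF, mul_eq_zero, or_iff_left hv] at hp
    refine p.rep_nonzero ?_
    rw [e, eq_zero_of_pow_eq_zero hp, zero_smul]
  refine ⟨(b ⬝ᵥ p.rep) / (a ⬝ᵥ p.rep), a ⬝ᵥ p.rep, ha, ?_⟩
  rw [smul_add, smul_smul, mul_div_cancel₀ _ ha]
  exact e

theorem IsPlaneBasis.exists_point {w u v a b : Fin 3 → ℝ} (h : IsPlaneBasis w u v a b) (t : ℝ) :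
    ∃ p : RP2, HasParameter u v p t := by
  have hne : u + t • v ≠ 0 := by
    intro h0
    have := congrArg (a ⬝ᵥ ·) h0
    simp [h.au, h.av] at this
  obtain ⟨k, hk⟩ := Projectivization.exists_smul_eq_mk_rep ℝ _ hne
  exact ⟨Projectivization.mk ℝ _ hne, k, k.ne_zero, hk.symm⟩

theorem HasParameter.eval_rep_eq_zero_iff {u v : Fin 3 → ℝ} {p : RP2} {t : ℝ}
    (hp : HasParameter u v p t) {G : MvPolynomial (Fin 3) ℝ} {d : ℕ} (hG : G.IsHomogeneous d) :
    eval p.rep G = 0 ↔ (lineRestriction u v G).eval t = 0 := by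
  obtain ⟨k, hk, e⟩ := hp
  rw [e, eval_smul_of_isHomogeneous hG, eval_lineRestriction, mul_eq_zero,
    or_iff_right (pow_ne_zero _ hk)]

theorem HasParameter.dotProduct_rep {w u v a b : Fin 3 → ℝ} (h : IsPlaneBasis w u v a b) {p : RP2}
    {t : ℝ} (hp : HasParameter u v p t) : w ⬝ᵥ p.rep = 0 := by
  obtain ⟨k, hk, e⟩ := hp
  simp [e, h.wu, h.wv]

theorem HasParameter.X_sub_C_pow_dvd {w u v a b : Fin 3 → ℝ} (h : IsPlaneBasis w u v a b)
    {x : RegularPoint F} {t : ℝ} (hx : HasParameter u v x.1 t) {m d : ℕ}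
    {G : MvPolynomial (Fin 3) ℝ} (hGd : G.IsHomogeneous d)
    (hL : (m : ℕ∞) ≤ intersectionMultiplicity F (linearForm w) x)
    (hG : (m : ℕ∞) ≤ intersectionMultiplicity F G x) :
    (Polynomial.X - Polynomial.C t) ^ m ∣ lineRestriction u v G := by
  have hwx := hx.dotProduct_rep h
  obtain ⟨k, hk, e⟩ := hx
  rw [← X_pow_dvd_lineRestriction_iff hGd hk, ← e]
  exact X_pow_dvd_lineRestriction_of_mem h.w_ne hwx (by simp [h.wv]) hL hG

/-- Combines the two bounds after moving the base point to `x`. One of them is applied to `F`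
itself, whose multiplicity exceeds every `m`. -/
theorem HasParameter.intersectionMultiplicity_eq {w u v a b : Fin 3 → ℝ}
    (h : IsPlaneBasis w u v a b) {d : ℕ} (hF : F.IsHomogeneous d) (hv : eval v F ≠ 0)
    {x : RegularPoint F} {t : ℝ} (hx : HasParameter u v x.1 t) :
    intersectionMultiplicity F (linearForm w) x = (lineRestriction u v F).rootMultiplicity t := by
  have hne : lineRestriction u v F ≠ 0 := by
    intro h0
    rw [← (lineRestriction_natDegree_le_and_coeff u v hF).2, h0] at hv
    simp at hv
  refine ENat.eq_of_forall_natCast_le_iff fun m => ?_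
  rw [Nat.cast_le, Polynomial.le_rootMultiplicity_iff hne]
  constructor
  · intro hm
    refine hx.X_sub_C_pow_dvd h hF hm ?_
    rw [coe_le_intersectionMultiplicity_iff]
    exact Ideal.mem_sup_left (Ideal.mem_span_singleton_self F)
  · intro hm
    obtain ⟨k, hk, e⟩ := hx
    rw [← X_pow_dvd_lineRestriction_iff hF hk, ← e] at hm
    have h' := h.move (t := t) hk
    rw [← e] at h'
    exact le_intersectionMultiplicity_linearForm hF h' hm

theorem IsIrreducibleCircularCubic.not_linearForm_dvd (hF : IsIrreducibleCircularCubic F)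
    {w : Fin 3 → ℝ} (hw : w ≠ 0) : ¬ linearForm w ∣ F := by
  rintro ⟨H, hH⟩
  have hdeg : ∀ {P : MvPolynomial (Fin 3) ℝ}, IsUnit P → P.totalDegree = 0 := fun hu =>
    (isUnit_iff_totalDegree_of_isReduced.1 hu).2
  have hF3 := hF.isHomogeneous.totalDegree hF.irreducible.ne_zero
  have hL1 := (isHomogeneous_linearForm w).totalDegree (linearForm_ne_zero hw)
  rcases hF.irreducible.isUnit_or_isUnit hH with hu | hu
  · have := hdeg hu
    omega
  · have h1 := totalDegree_mul (linearForm w) H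
    rw [← hH, hF3, hL1, hdeg hu] at h1
    omega

/-- No line divides `F`, so the missed point `v` can be chosen off the cubic. Then every point of
the cubic on the line has a parameter and the restricted cubic has degree exactly three. -/
theorem IsIrreducibleCircularCubic.exists_frame (hF : IsIrreducibleCircularCubic F)
    {w : Fin 3 → ℝ} (hw : w ≠ 0) :
    ∃ u v a b, IsPlaneBasis w u v a b ∧ eval v F ≠ 0 := by
  have := mt (linearForm_dvd hw (G := F)) (hF.not_linearForm_dvd hw)
  push Not at this
  obtain ⟨v, hwv, hv⟩ := this
  have hv0 : v ≠ 0 := by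
    rintro rfl
    apply hv
    have := eval_smul_of_isHomogeneous hF.isHomogeneous 0 0
    simpa using this
  obtain ⟨u, a, b, h⟩ := exists_isPlaneBasis hw hv0 hwv
  exact ⟨u, v, a, b, h, hv⟩

open Classical in
theorem HasParameter.count_eq {w u v a b : Fin 3 → ℝ} (h : IsPlaneBasis w u v a b)
    {x p q r : RegularPoint F} {tx tp tq tr : ℝ} (hx : HasParameter u v x.1 tx)
    (hp : HasParameter u v p.1 tp) (hq : HasParameter u v q.1 tq)
    (hr : HasParameter u v r.1 tr) :
    Multiset.count x {p, q, r} = Multiset.count tx {tp, tq, tr} := by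
  have key : ∀ {y : RegularPoint F} {t : ℝ}, HasParameter u v y.1 t → (x = y ↔ tx = t) :=
    fun hy => Subtype.ext_iff.trans (hx.eq_iff h hy)
  simp only [Multiset.insert_eq_cons, Multiset.count_cons, Multiset.count_singleton, key hp,
    key hq, key hr]

theorem X_sub_C_mul_X_sub_C_dvd {P : Polynomial ℝ} {s t : ℝ} (hs : P.eval s = 0)
    (ht : P.eval t = 0) (hst : s = t → P.derivative.eval s = 0) :
    (Polynomial.X - Polynomial.C s) * (Polynomial.X - Polynomial.C t) ∣ P := by
  obtain ⟨Q, rfl⟩ := Polynomial.dvd_iff_isRoot.2 hs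
  refine mul_dvd_mul_left _ (Polynomial.dvd_iff_isRoot.2 ?_)
  by_cases h : s = t
  · have := hst h
    subst h
    simpa using this
  · simpa [sub_eq_zero, Ne.symm h] using ht

/-- The gradient of `F` at `x`. -/
noncomputable def gradientAt (F : MvPolynomial (Fin 3) ℝ) (x : RegularPoint F) : Fin 3 → ℝ :=
  fun i => eval x.1.rep (pderiv i F)

theorem gradientAt_dotProduct {d : ℕ} (hF : F.IsHomogeneous d) (x : RegularPoint F) :
    gradientAt F x ⬝ᵥ x.1.rep = 0 := by
  have := congrArg (eval x.1.rep) hF.sum_X_mul_pderiv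
  simp [eval_rep_eq_zero x] at this
  rw [← this, dotProduct]
  exact Finset.sum_congr rfl fun i _ => mul_comm _ _

/-- The line through two regular points, the tangent line if they coincide. -/
theorem exists_secant {d : ℕ} (hF : F.IsHomogeneous d) (a b : RegularPoint F) :
    ∃ n : Fin 3 → ℝ, n ≠ 0 ∧ n ⬝ᵥ a.1.rep = 0 ∧ n ⬝ᵥ b.1.rep = 0 ∧ (a = b → n = gradientAt F a) ∧
      ∀ w, w ⬝ᵥ a.1.rep = 0 → w ⬝ᵥ b.1.rep = 0 → (a = b → ∃ c : ℝ, w = c • gradientAt F a) →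
        ∃ c : ℝ, w = c • n := by
  by_cases hab : a = b
  · subst hab
    refine ⟨gradientAt F a, ?_, gradientAt_dotProduct hF a, gradientAt_dotProduct hF a,
      fun _ => rfl, fun w _ _ hw => hw rfl⟩
    obtain ⟨i, hi⟩ := a.2.2
    exact fun h => hi (congrFun h i)
  · set n := crossProduct a.1.rep b.1.rep with hn
    have hn0 : n ≠ 0 := by
      rw [hn, crossProduct_ne_zero_iff_linearIndependent]
      exact (Projectivization.linearIndependent_pair_iff_ne).2 fun h => hab (Subtype.ext h)
    refine ⟨n, hn0, ?_, ?_, fun h => absurd h hab, fun w hwa hwb _ => ?_⟩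
    · rw [dotProduct_comm]; exact dot_self_cross _ _
    · rw [dotProduct_comm]; exact dot_cross_self _ _
    · have hn2 : n ⬝ᵥ n ≠ 0 := fun h => hn0 (dotProduct_self_eq_zero.1 h)
      refine ⟨(n ⬝ᵥ n)⁻¹ * (n ⬝ᵥ w), ?_⟩
      have := cross_dot_cross_smul_eq a.1.rep b.1.rep w
      rw [dotProduct_comm a.1.rep w, dotProduct_comm b.1.rep w, hwa, hwb, ← hn] at this
      rw [mul_smul, eq_inv_smul_iff₀ hn2, this]
      simp

open Classical in
-- The restricted cubic has the parameters of `a` and `b` as roots, a double one in the tangent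
-- case. The remaining factor is linear over `ℝ`, and its root is the third point.
theorem IsIrreducibleCircularCubic.exists_isLineSection (hF : IsIrreducibleCircularCubic F)
    (a b : RegularPoint F) : ∃ c, IsLineSection F a b c := by
  obtain ⟨w, hw, hwa, hwb, hab, -⟩ := exists_secant hF.isHomogeneous a b
  obtain ⟨u, v, α, β, h, hv⟩ := hF.exists_frame hw
  obtain ⟨s, hs⟩ := h.exists_hasParameter hF.isHomogeneous hv a.2.1 hwa
  obtain ⟨t, ht⟩ := h.exists_hasParameter hF.isHomogeneous hv b.2.1 hwb
  set f := lineRestriction u v F with hf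
  have hdeg := lineRestriction_natDegree_le_and_coeff u v hF.isHomogeneous
  rw [← hf] at hdeg
  have hf3 : f.natDegree = 3 :=
    le_antisymm hdeg.1 (Polynomial.le_natDegree_of_ne_zero (hdeg.2.trans_ne hv))
  have hf0 : f ≠ 0 := by
    rintro h0
    rw [h0] at hf3
    simp at hf3
  obtain ⟨g, hg⟩ : (Polynomial.X - Polynomial.C s) * (Polynomial.X - Polynomial.C t) ∣ f := by
    refine X_sub_C_mul_X_sub_C_dvd ((hs.eval_rep_eq_zero_iff hF.isHomogeneous).1 a.2.1)
      ((ht.eval_rep_eq_zero_iff hF.isHomogeneous).1 b.2.1) fun hst => ?_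
    have hab' : a = b := Subtype.ext ((hs.eq_iff h ht).2 hst)
    have hgrad := h.wv
    rw [hab hab'] at hgrad
    obtain ⟨k, hk, e⟩ := hs
    rw [hf, derivative_lineRestriction, Polynomial.eval_finsetSum]
    -- The partial derivatives have degree two, so passing to the representative of `a` costs `k ^
    -- 2`.
    have : ∀ i, k ^ (3 - 1) * ((lineRestriction u v (pderiv i F) * Polynomial.C (v i)).eval s)
        = gradientAt F a i * v i := by
      intro i
      rw [Polynomial.eval_mul, eval_lineRestriction, Polynomial.eval_C, gradientAt, e,
        eval_smul_of_isHomogeneous hF.isHomogeneous.pderiv, mul_assoc]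
    have hsum := Finset.sum_congr (s₁ := Finset.univ) rfl fun i _ => this i
    rw [← Finset.mul_sum] at hsum
    exact (mul_eq_zero.1 (hsum.trans hgrad)).resolve_left (pow_ne_zero _ hk)
  have hg0 : g ≠ 0 := by
    rintro rfl
    exact hf0 (by rw [hg, mul_zero])
  have hg1 : g.natDegree = 1 := by
    rw [hg, Polynomial.natDegree_mul (mul_ne_zero (Polynomial.X_sub_C_ne_zero _)
      (Polynomial.X_sub_C_ne_zero _)) hg0, Polynomial.natDegree_mul (Polynomial.X_sub_C_ne_zero _)
      (Polynomial.X_sub_C_ne_zero _), Polynomial.natDegree_X_sub_C,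
      Polynomial.natDegree_X_sub_C] at hf3
    omega
  obtain ⟨r, hr⟩ := Polynomial.exists_root_of_degree_eq_one
    ((Polynomial.degree_eq_iff_natDegree_eq hg0).2 hg1)
  have hroots : f.roots = {s, t, r} := by
    have hgr : g.roots = {r} := by
      have hle : {r} ≤ g.roots :=
        Multiset.singleton_le.2 ((Polynomial.mem_roots hg0).2 hr)
      exact (Multiset.eq_of_le_of_card_le hle (by simpa [hg1] using Polynomial.card_roots' g)).symm
    have hf0' := hf0
    rw [hg] at hf0'
    rw [hg, Polynomial.roots_mul hf0', Polynomial.roots_mul (left_ne_zero_of_mul hf0'),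
      Polynomial.roots_X_sub_C, Polynomial.roots_X_sub_C, hgr]
    rfl
  obtain ⟨c, hc⟩ := h.exists_point r
  have hcF : OnCurve F c := by
    rw [OnCurve, hc.eval_rep_eq_zero_iff hF.isHomogeneous, ← hf, hg]
    simp [hr.eq_zero]
  -- At a singular point the restricted cubic has a multiple root, which would have to coincide with
  -- `s` or `t`; but `a` and `b` are regular.
  have hcr : IsRegularPoint F c := by
    by_contra hsing
    have hsing' : ∀ i, eval c.rep (pderiv i F) = 0 := by
      intro i
      by_contra hi
      exact hsing ⟨hcF, i, hi⟩
    have hder : f.derivative.eval r = 0 := by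
      rw [hf, derivative_lineRestriction, Polynomial.eval_finsetSum]
      refine Finset.sum_eq_zero fun i _ => ?_
      rw [Polynomial.eval_mul,
        (hc.eval_rep_eq_zero_iff hF.isHomogeneous.pderiv).1 (hsing' i), zero_mul]
    have hca : c ≠ a.1 := by
      rintro rfl
      exact hsing a.2
    have hcb : c ≠ b.1 := by
      rintro rfl
      exact hsing b.2
    have hrs : r ≠ s := mt (hc.eq_iff h hs).2 hca
    have hrt : r ≠ t := mt (hc.eq_iff h ht).2 hcb
    have h2 : 1 < f.rootMultiplicity r := by
      rw [Polynomial.one_lt_rootMultiplicity_iff_isRoot hf0]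
      refine ⟨?_, hder⟩
      rw [hg]
      simp [hr.eq_zero]
    rw [← Polynomial.count_roots, hroots] at h2
    simp [hrs, hrt] at h2
  refine ⟨⟨c, hcr⟩, linearForm w, linearForm_ne_zero hw, isHomogeneous_linearForm w,
    fun p hp hpw => ?_, fun x => ?_⟩
  · rw [OnCurve, eval_linearForm] at hpw
    obtain ⟨q, hq⟩ := h.exists_hasParameter hF.isHomogeneous hv hp hpw
    have hqr : q ∈ f.roots :=
      (Polynomial.mem_roots hf0).2 ((hq.eval_rep_eq_zero_iff hF.isHomogeneous).1 hp)
    rw [hroots] at hqr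
    simp only [Multiset.insert_eq_cons, Multiset.mem_cons, Multiset.mem_singleton] at hqr
    rcases hqr with hqr | hqr | hqr
    · rw [(hq.eq_iff h hs).2 hqr]; exact a.2
    · rw [(hq.eq_iff h ht).2 hqr]; exact b.2
    · rw [(hq.eq_iff h hc).2 hqr]; exact hcr
  · by_cases hwx : w ⬝ᵥ x.1.rep = 0
    · obtain ⟨q, hq⟩ := h.exists_hasParameter hF.isHomogeneous hv x.2.1 hwx
      rw [hq.intersectionMultiplicity_eq h hF.isHomogeneous hv, ← hf,
        hq.count_eq h hs ht (r := ⟨c, hcr⟩) hc, ← Polynomial.count_roots, hroots]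
    · rw [intersectionMultiplicity_eq_zero_iff.2 (by rwa [eval_linearForm]), eq_comm,
        Nat.cast_eq_zero, Multiset.count_eq_zero]
      intro hmem
      rcases Multiset.mem_cons.1 hmem with rfl | hmem
      · exact hwx hwa
      rcases Multiset.mem_cons.1 hmem with rfl | hmem
      · exact hwx hwb
      · rw [Multiset.mem_singleton.1 hmem] at hwx
        exact hwx (hc.dotProduct_rep h)

open Classical in
-- The line is forced up to a scalar: if `a = b`, multiplicity two makes it parallel to the
-- gradient. Equal multiplicities give equal multisets, from which `a, b` cancel.
theorem IsLineSection.right_unique {d : ℕ} (hF : F.IsHomogeneous d) {a b c c' : RegularPoint F}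
    (h : IsLineSection F a b c) (h' : IsLineSection F a b c') : c = c' := by
  obtain ⟨n, hn, -, -, -, huniq⟩ := exists_secant hF a b
  have key : ∀ {e : RegularPoint F}, IsLineSection F a b e → ∀ x,
      intersectionMultiplicity F (linearForm n) x = (Multiset.count x {a, b, e} : ℕ∞) := by
    rintro e ⟨L, hL0, hL, -, hm⟩ x
    obtain ⟨w, rfl⟩ := exists_eq_linearForm hL
    have hmem : ∀ y ∈ ({a, b, e} : Multiset (RegularPoint F)), w ⬝ᵥ y.1.rep = 0 := by
      intro y hy
      rw [← eval_linearForm, ← one_le_intersectionMultiplicity_iff, hm y]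
      exact_mod_cast Multiset.one_le_count_iff_mem.2 hy
    obtain ⟨c, rfl⟩ := huniq w (hmem a (by simp)) (hmem b (by simp)) fun hab => by
      subst hab
      have h2 : 2 ≤ intersectionMultiplicity F (linearForm w) a := by
        rw [hm a]
        have : 2 ≤ Multiset.count a {a, a, e} := by
          simp
        exact_mod_cast this
      obtain ⟨c, hc⟩ := exists_eval_pderiv_eq h2
      refine ⟨c, funext fun i => ?_⟩
      rw [← eval_pderiv_linearForm w a.1.rep i, hc i]
      rfl
    have hc : c ≠ 0 := by
      rintro rfl
      simp [linearForm_zero] at hL0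
    rw [← hm x, linearForm_smul, intersectionMultiplicity_C_mul hc]
  have heq : ({a, b, c} : Multiset (RegularPoint F)) = {a, b, c'} := by
    ext x
    exact_mod_cast (key h x).symm.trans (key h' x)
  simpa [Multiset.insert_eq_cons] using heq

theorem IsIrreducibleCircularCubic.thirdPoint_eq_iff (hF : IsIrreducibleCircularCubic F)
    {a b c : RegularPoint F} : thirdPoint a b = c ↔ IsLineSection F a b c := by
  have hs : IsLineSection F a b (thirdPoint a b) :=
    @Classical.epsilon_spec _ (fun c => IsLineSection F a b c) (hF.exists_isLineSection a b)
  constructor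
  · rintro rfl
    exact hs
  · exact fun h => hs.right_unique hF.isHomogeneous h

theorem IsLineSection.swap {a b c : RegularPoint F} (h : IsLineSection F a b c) :
    IsLineSection F b a c := by
  rwa [IsLineSection, Multiset.insert_eq_cons, Multiset.insert_eq_cons, Multiset.cons_swap]

theorem IsLineSection.swap_right {a b c : RegularPoint F} (h : IsLineSection F a b c) :
    IsLineSection F a c b := by
  have e : ({a, c, b} : Multiset (RegularPoint F)) = {a, b, c} :=
    congrArg (a ::ₘ ·) (Multiset.pair_comm c b)
  rwa [IsLineSection, e]

theorem IsLineSection.rotate {a b c : RegularPoint F} (h : IsLineSection F a b c) :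
    IsLineSection F b c a :=
  h.swap.swap_right

theorem IsLineSection.left_unique {d : ℕ} (hF : F.IsHomogeneous d) {a a' b c : RegularPoint F}
    (h : IsLineSection F a b c) (h' : IsLineSection F a' b c) : a = a' :=
  h.rotate.right_unique hF h'.rotate

/-- Any two points of a line section determine the third. This strips off in turn the outer `* o`,
then `d`, then `c`, leaving `(a * b) * o = c * d`. -/
theorem IsIrreducibleCircularCubic.groupSum_eq_omegaPoint_iff (hF : IsIrreducibleCircularCubic F)
    (a b c d : RegularPoint F) :
    groupSum hF (groupSum hF (groupSum hF a b) c) d = omegaPoint hF ↔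
      IsLineSection F (thirdPoint a b) (thirdPoint c d) (identityPoint hF) := by
  have ls : ∀ x y, IsLineSection F x y (thirdPoint x y) := fun x y => hF.thirdPoint_eq_iff.1 rfl
  rw [groupSum, omegaPoint, hF.thirdPoint_eq_iff]
  have h1 : ∀ {e}, IsLineSection F e (identityPoint hF)
      (thirdPoint (identityPoint hF) (identityPoint hF)) ↔ e = identityPoint hF := fun {e} =>
    ⟨fun h => h.left_unique hF.isHomogeneous (ls _ _), fun h => h ▸ ls _ _⟩
  rw [h1, hF.thirdPoint_eq_iff]
  have h2 : ∀ {y}, IsLineSection F (thirdPoint y (identityPoint hF)) d (identityPoint hF)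
      ↔ y = d := fun {y} =>
    ⟨fun h => (ls _ _).left_unique hF.isHomogeneous h.rotate, fun h => h ▸ (ls _ _).rotate.rotate⟩
  rw [groupSum, h2, hF.thirdPoint_eq_iff]
  have h3 : ∀ {s}, IsLineSection F s c d ↔ s = thirdPoint c d := fun {s} =>
    ⟨fun h => h.left_unique hF.isHomogeneous (ls _ _).rotate.rotate,
      fun h => h ▸ (ls _ _).rotate.rotate⟩
  rw [h3, groupSum, hF.thirdPoint_eq_iff]
  exact ⟨IsLineSection.swap_right, IsLineSection.swap_right⟩

end ThirdPoint

/-! ### Division by lines and the two implications -/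

section GeneralisedCircles

variable {F : MvPolynomial (Fin 3) ℝ}

/-- Any quotient may be replaced by its component of degree `n`, the only one that contributes in
degree `n + 1`. -/
theorem exists_isHomogeneous_eq_mul {σ R : Type*} [CommRing R] {L G : MvPolynomial σ R} {n : ℕ}
    (hL : L.IsHomogeneous 1) (hG : G.IsHomogeneous (n + 1)) (h : L ∣ G) :
    ∃ M : MvPolynomial σ R, M.IsHomogeneous n ∧ G = L * M := by
  obtain ⟨M, rfl⟩ := h
  refine ⟨homogeneousComponent n M, homogeneousComponent_isHomogeneous n M, ?_⟩
  rw [← homogeneousComponent_eq_self hG]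
  conv_lhs => rw [← sum_homogeneousComponent M]
  rw [Finset.mul_sum, map_sum, Finset.sum_eq_single n]
  · rw [homogeneousComponent_of_mem (m := n + 1), if_pos rfl]
    rw [add_comm]
    exact hL.mul (homogeneousComponent_isHomogeneous n M)
  · intro i _ hi
    refine (homogeneousComponent_of_mem
      (hL.mul (homogeneousComponent_isHomogeneous i M))).trans (if_neg (by omega))
  · intro hn
    rw [homogeneousComponent_eq_zero n M (by simpa using hn), mul_zero, map_zero]

theorem IntersectsExactlyIn.eval_rep_eq_zero {G : MvPolynomial (Fin 3) ℝ}
    {s : Multiset (RegularPoint F)} (h : IntersectsExactlyIn F G s) {x : RegularPoint F}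
    (hx : x ∈ s) : eval x.1.rep G = 0 := by
  classical
  rw [← one_le_intersectionMultiplicity_iff, h.2 x]
  exact_mod_cast Multiset.one_le_count_iff_mem.2 hx

open Classical in
-- The restriction of `G` has three roots counted with multiplicity but degree at most two, so it is
-- zero.
theorem linearForm_dvd_of_natDegree_le_two {d : ℕ} (hF : F.IsHomogeneous d)
    {w u v α β : Fin 3 → ℝ} (h : IsPlaneBasis w u v α β) (hv : eval v F ≠ 0)
    {a b c : RegularPoint F} (hL : IntersectsExactlyIn F (linearForm w) {a, b, c})
    {G : MvPolynomial (Fin 3) ℝ} {e : ℕ} (hG : G.IsHomogeneous e)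
    (hm : ∀ x, (Multiset.count x {a, b, c} : ℕ∞) ≤ intersectionMultiplicity F G x)
    (hdeg : (lineRestriction u v G).natDegree ≤ 2) : linearForm w ∣ G := by
  refine h.linearForm_dvd_of_lineRestriction_eq_zero hG ?_
  by_contra h0
  have par : ∀ x ∈ ({a, b, c} : Multiset (RegularPoint F)), ∃ t, HasParameter u v x.1 t :=
    fun x hx => h.exists_hasParameter hF hv x.2.1
      (by rw [← eval_linearForm]; exact hL.eval_rep_eq_zero hx)
  obtain ⟨ta, ha⟩ := par a (by simp)
  obtain ⟨tb, hb⟩ := par b (by simp)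
  obtain ⟨tc, hc⟩ := par c (by simp)
  have key : ∀ {x : RegularPoint F} {t : ℝ}, HasParameter u v x.1 t →
      Multiset.count t {ta, tb, tc} ≤ (lineRestriction u v G).rootMultiplicity t := by
    intro x t hx
    rw [Polynomial.le_rootMultiplicity_iff h0, ← hx.count_eq h ha hb hc]
    exact hx.X_sub_C_pow_dvd h hG (hL.2 x).ge (hm x)
  have hle : {ta, tb, tc} ≤ (lineRestriction u v G).roots := by
    rw [Multiset.le_iff_count]
    intro t
    rw [Polynomial.count_roots]
    by_cases ht : t ∈ ({ta, tb, tc} : Multiset ℝ)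
    · simp only [Multiset.insert_eq_cons, Multiset.mem_cons, Multiset.mem_singleton] at ht
      rcases ht with rfl | rfl | rfl
      · exact key ha
      · exact key hb
      · exact key hc
    · rw [Multiset.count_eq_zero.2 ht]
      exact Nat.zero_le _
  have := (Multiset.card_le_card hle).trans ((Polynomial.card_roots' _).trans hdeg)
  simp at this

open Classical in
theorem IsIrreducibleCircularCubic.linearForm_dvd_of_conic (hF : IsIrreducibleCircularCubic F)
    {w : Fin 3 → ℝ} (hw : w ≠ 0)
    {a b c : RegularPoint F} (hL : IntersectsExactlyIn F (linearForm w) {a, b, c})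
    {G : MvPolynomial (Fin 3) ℝ} (hG : G.IsHomogeneous 2)
    (hm : ∀ x, (Multiset.count x {a, b, c} : ℕ∞) ≤ intersectionMultiplicity F G x) :
    linearForm w ∣ G := by
  obtain ⟨u, v, α, β, h, hv⟩ := hF.exists_frame hw
  exact linearForm_dvd_of_natDegree_le_two hF.isHomogeneous h hv hL hG hm
    (lineRestriction_natDegree_le_and_coeff u v hG).1

open Classical in
theorem IsIrreducibleCircularCubic.exists_linearForm_dvd_sub (hF : IsIrreducibleCircularCubic F)
    {w : Fin 3 → ℝ} (hw : w ≠ 0)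
    {a b c : RegularPoint F} (hL : IntersectsExactlyIn F (linearForm w) {a, b, c})
    {G : MvPolynomial (Fin 3) ℝ} (hG : G.IsHomogeneous 3)
    (hm : ∀ x, (Multiset.count x {a, b, c} : ℕ∞) ≤ intersectionMultiplicity F G x) :
    ∃ (r : ℝ) (M : MvPolynomial (Fin 3) ℝ), M.IsHomogeneous 2 ∧ G - C r * F = linearForm w * M := by
  obtain ⟨u, v, α, β, h, hv⟩ := hF.exists_frame hw
  -- This `r` makes `G - r F` vanish at `v`, which kills the cubic coefficient on the line.
  set r := eval v G / eval v F with hr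
  have hhom : (G - C r * F).IsHomogeneous 3 := hG.sub (hF.isHomogeneous.C_mul r)
  refine ⟨r, exists_isHomogeneous_eq_mul (isHomogeneous_linearForm w) hhom ?_⟩
  refine linearForm_dvd_of_natDegree_le_two hF.isHomogeneous h hv hL hhom
    (fun x => by rw [intersectionMultiplicity_sub_mul]; exact hm x) ?_
  have hd := lineRestriction_natDegree_le_and_coeff u v hhom
  have hc : eval v (G - C r * F) = 0 := by simp [hr, hv]
  rw [hc] at hd
  by_contra hlt
  have h3 : (lineRestriction u v (G - C r * F)).natDegree = 3 := by omega
  have h0 : lineRestriction u v (G - C r * F) = 0 := by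
    rw [← Polynomial.leadingCoeff_eq_zero, Polynomial.leadingCoeff, h3]
    exact hd.2
  rw [h0] at h3
  simp at h3

theorem aeval_linearForm_circular (w : Fin 3 → ℝ) :
    (aeval ![Complex.I, 1, 0] (linearForm w) : ℂ) = w 1 + w 0 * Complex.I ∧
      (aeval ![-Complex.I, 1, 0] (linearForm w) : ℂ) = w 1 - w 0 * Complex.I := by
  simp [linearForm, Fin.sum_univ_three]
  constructor <;> ring

theorem eq_C_mul_X_two_of_circular {w : Fin 3 → ℝ}
    (h : (aeval ![Complex.I, 1, 0] (linearForm w) : ℂ) = 0 ∨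
      (aeval ![-Complex.I, 1, 0] (linearForm w) : ℂ) = 0) : linearForm w = C (w 2) * X 2 := by
  rw [(aeval_linearForm_circular w).1, (aeval_linearForm_circular w).2] at h
  have h01 : w 0 = 0 ∧ w 1 = 0 := by
    rcases h with h | h <;>
    · have hre := congrArg Complex.re h
      have him := congrArg Complex.im h
      simp at hre him
      exact ⟨him, hre⟩
  simp [linearForm, Fin.sum_univ_three, h01.1, h01.2]

/-- A line with three real intersection points does not contain the circular points. -/
theorem IsIrreducibleCircularCubic.aeval_linearForm_ne_zero (hF : IsIrreducibleCircularCubic F)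
    {w : Fin 3 → ℝ} (hw : w ≠ 0) {a b c : RegularPoint F}
    (hL : IntersectsExactlyIn F (linearForm w) {a, b, c}) :
    (aeval ![Complex.I, 1, 0] (linearForm w) : ℂ) ≠ 0 ∧
      (aeval ![-Complex.I, 1, 0] (linearForm w) : ℂ) ≠ 0 := by
  classical
  by_contra hcon
  have e := eq_C_mul_X_two_of_circular (w := w) (by tauto)
  have hw2 : w 2 ≠ 0 := by
    intro h0
    rw [h0, C_0, zero_mul] at e
    exact linearForm_ne_zero hw e
  -- The line would be `z = 0`, which has one real intersection, not three.
  have heq : ({a, b, c} : Multiset (RegularPoint F)) = {identityPoint hF} := by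
    ext x
    have h1 := hL.2 x
    rw [e, intersectionMultiplicity_C_mul hw2, hF.intersectsExactlyIn_X_two.2 x] at h1
    exact_mod_cast h1.symm
  simpa using congrArg Multiset.card heq

open Classical in
theorem IsIrreducibleCircularCubic.exists_generalisedCircle (hF : IsIrreducibleCircularCubic F)
    {a b c d p q : RegularPoint F} (h₁ : IsLineSection F a b p) (h₂ : IsLineSection F c d q)
    (h₃ : IsLineSection F p q (identityPoint hF)) :
    ∃ Q, IsGeneralisedCircle Q ∧ IntersectsExactlyIn F Q {a, b, c, d} := by
  obtain ⟨L₁, hL₁0, hL₁, hI₁⟩ := h₁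
  obtain ⟨L₂, hL₂0, hL₂, hI₂⟩ := h₂
  obtain ⟨L₃, hL₃0, hL₃, hI₃⟩ := h₃
  obtain ⟨w, rfl⟩ := exists_eq_linearForm hL₃
  have hw : w ≠ 0 := by
    rintro rfl
    exact hL₃0 linearForm_zero
  have hZ := hF.intersectsExactlyIn_X_two
  set G : MvPolynomial (Fin 3) ℝ := L₁ * L₂ * X 2 with hG
  have hGh : G.IsHomogeneous 3 := (hL₁.mul hL₂).mul (isHomogeneous_X ℝ 2)
  have hms : ({a, b, p} + {c, d, q} + {identityPoint hF} : Multiset (RegularPoint F))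
      = {p, q, identityPoint hF} + {a, b, c, d} := by
    ext x
    simp only [Multiset.insert_eq_cons, Multiset.count_add, Multiset.count_cons,
      Multiset.count_singleton]
    ring
  have hGm : ∀ x, intersectionMultiplicity F G x
      = (Multiset.count x {p, q, identityPoint hF} : ℕ∞) + (Multiset.count x {a, b, c, d} : ℕ) := by
    intro x
    rw [hG, intersectionMultiplicity_mul, intersectionMultiplicity_mul, hI₁.2, hI₂.2, hZ.2]
    have := congrArg (Multiset.count x) hms
    rw [Multiset.count_add, Multiset.count_add, Multiset.count_add] at this
    exact_mod_cast this
  obtain ⟨r, Q, hQ, hGQ⟩ := hF.exists_linearForm_dvd_sub hw hI₃ hGh fun x => by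
    rw [hGm x]; exact le_self_add
  -- Otherwise `L₁ L₂ z = r F` with `r ≠ 0`, and `L₁` would divide `F`.
  have hQ0 : Q ≠ 0 := by
    rintro rfl
    rw [mul_zero, sub_eq_zero] at hGQ
    have hG0 : G ≠ 0 := mul_ne_zero (mul_ne_zero hL₁0 hL₂0) (X_ne_zero 2)
    obtain ⟨w₁, rfl⟩ := exists_eq_linearForm hL₁
    have hr : r ≠ 0 := by
      rintro rfl
      rw [C_0, zero_mul] at hGQ
      exact hG0 hGQ
    refine hF.not_linearForm_dvd (w := w₁) (fun h0 => hL₁0 (by rw [h0, linearForm_zero])) ?_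
    have hu : IsUnit (C r : MvPolynomial (Fin 3) ℝ) := (isUnit_iff_ne_zero.2 hr).map C
    rw [← hu.dvd_mul_left, ← hGQ, hG, mul_assoc]
    exact dvd_mul_right _ _
  refine ⟨Q, ⟨hQ0, hQ, ?_⟩, fun y hyF hyQ => ?_, fun x => ?_⟩
  · have hne := hF.aeval_linearForm_ne_zero hw hI₃
    have hc := hF.containsCircularPoints
    constructor
    · have := congrArg (aeval ![Complex.I, 1, 0] : _ → ℂ) hGQ
      rw [map_sub, map_mul _ (C r) F, hc.1, hG, map_mul, map_mul, map_mul] at this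
      simpa [hne.1] using this.symm
    · have := congrArg (aeval ![-Complex.I, 1, 0] : _ → ℂ) hGQ
      rw [map_sub, map_mul _ (C r) F, hc.2, hG, map_mul, map_mul, map_mul] at this
      simpa [hne.2] using this.symm
  -- A common zero of `F` and `Q` lies on `L₁`, `L₂` or `z = 0`, and all their points on the cubic
  -- are regular.
  · have := congrArg (eval y.rep) hGQ
    rw [map_sub, map_mul _ (C r) F, map_mul _ _ Q, show eval y.rep F = 0 from hyF,
      show eval y.rep Q = 0 from hyQ, hG, map_mul, map_mul, mul_zero, mul_zero, sub_zero,
      mul_eq_zero, mul_eq_zero] at this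
    rcases this with (h | h) | h
    · exact hI₁.1 y hyF h
    · exact hI₂.1 y hyF h
    · exact hZ.1 y hyF h
  · have h1 := intersectionMultiplicity_sub_mul (F := F) G (C r) x
    rw [hGQ, intersectionMultiplicity_mul, hGm x, hI₃.2] at h1
    exact WithTop.add_left_cancel (ENat.natCast_ne_top _) h1

open Classical in
theorem IsIrreducibleCircularCubic.isLineSection_of_generalisedCircle
    (hF : IsIrreducibleCircularCubic F) {a b c d p q : RegularPoint F}
    (h₁ : IsLineSection F a b p) (h₂ : IsLineSection F c d q) {Q : MvPolynomial (Fin 3) ℝ}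
    (hQ : IsGeneralisedCircle Q) (hQF : IntersectsExactlyIn F Q {a, b, c, d}) :
    IsLineSection F p q (identityPoint hF) := by
  obtain ⟨r, h₃⟩ := hF.exists_isLineSection p q
  suffices hr : r = identityPoint hF from hr ▸ h₃
  obtain ⟨L₁, hL₁0, hL₁, hI₁⟩ := h₁
  obtain ⟨L₂, hL₂0, hL₂, hI₂⟩ := h₂
  obtain ⟨L₃, hL₃0, hL₃, hI₃⟩ := h₃
  obtain ⟨w₁, rfl⟩ := exists_eq_linearForm hL₁
  obtain ⟨w₂, rfl⟩ := exists_eq_linearForm hL₂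
  obtain ⟨w₃, rfl⟩ := exists_eq_linearForm hL₃
  have hw : ∀ {w : Fin 3 → ℝ}, linearForm w ≠ 0 → w ≠ 0 := by
    rintro _ h rfl
    exact h linearForm_zero
  set G := linearForm w₃ * Q with hG
  have hGh : G.IsHomogeneous 3 := hL₃.mul hQ.2.1
  have hms : ({p, q, r} + {a, b, c, d} : Multiset (RegularPoint F))
      = {a, b, p} + ({c, d, q} + {r}) := by
    ext x
    simp only [Multiset.insert_eq_cons, Multiset.count_add, Multiset.count_cons,
      Multiset.count_singleton]
    ring
  have hGm : ∀ x, intersectionMultiplicity F G x = (Multiset.count x {a, b, p} : ℕ∞)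
      + ((Multiset.count x {c, d, q} : ℕ∞) + (Multiset.count x {r} : ℕ)) := by
    intro x
    rw [hG, intersectionMultiplicity_mul, hI₃.2, hQF.2]
    have := congrArg (Multiset.count x) hms
    rw [Multiset.count_add, Multiset.count_add, Multiset.count_add] at this
    exact_mod_cast this
  obtain ⟨s, M, hM, hGM⟩ := hF.exists_linearForm_dvd_sub (hw hL₁0) hI₁ hGh fun x => by
    rw [hGm x]; exact le_self_add
  have hMm : ∀ x, intersectionMultiplicity F M x
      = (Multiset.count x {c, d, q} : ℕ∞) + (Multiset.count x {r} : ℕ) := by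
    intro x
    have h1 := intersectionMultiplicity_sub_mul (F := F) G (C s) x
    rw [hGM, intersectionMultiplicity_mul, hGm x, hI₁.2] at h1
    exact WithTop.add_left_cancel (ENat.natCast_ne_top _) h1
  have hdvd := hF.linearForm_dvd_of_conic (hw hL₂0) hI₂ hM fun x => by
    rw [hMm x]; exact le_self_add
  obtain ⟨N, hN, rfl⟩ := exists_isHomogeneous_eq_mul hL₂ hM hdvd
  obtain ⟨w, rfl⟩ := exists_eq_linearForm hN
  -- `Q` and `F` vanish at this circular point, while `L₁` and `L₂`, having three real intersections
  -- each, do not.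
  have hα : (aeval ![Complex.I, 1, 0] (linearForm w) : ℂ) = 0 := by
    have := congrArg (aeval ![Complex.I, 1, 0] : _ → ℂ) hGM
    rw [map_sub, map_mul _ (C s) F, hF.containsCircularPoints.1, hG, map_mul _ _ Q, hQ.2.2.1, map_mul,
      map_mul] at this
    simpa [(hF.aeval_linearForm_ne_zero (hw hL₁0) hI₁).1,
      (hF.aeval_linearForm_ne_zero (hw hL₂0) hI₂).1] using this.symm
  have hmult : ∀ x, intersectionMultiplicity F (linearForm w) x = (Multiset.count x {r} : ℕ) := by
    intro x
    have h1 := hMm x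
    rw [intersectionMultiplicity_mul, hI₂.2] at h1
    exact WithTop.add_left_cancel (ENat.natCast_ne_top _) h1
  refine hF.eq_identityPoint ?_
  have hr : eval r.1.rep (linearForm w) = 0 := by
    rw [← one_le_intersectionMultiplicity_iff, hmult r, Multiset.count_singleton_self,
      Nat.cast_one]
  have e := eq_C_mul_X_two_of_circular (Or.inl hα)
  -- Otherwise the residual form is zero and its multiplicity at `r` is infinite instead of one.
  have hw2 : w 2 ≠ 0 := by
    intro h0
    have h2 : ((2 : ℕ) : ℕ∞) ≤ intersectionMultiplicity F (linearForm w) r := by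
      rw [coe_le_intersectionMultiplicity_iff, e, h0, C_0, zero_mul]
      exact zero_mem _
    rw [hmult r, Multiset.count_singleton_self, Nat.cast_le] at h2
    omega
  rw [e] at hr
  simpa [hw2] using hr

end GeneralisedCircles

theorem proposition3p2 (F : MvPolynomial (Fin 3) ℝ) (hF : IsIrreducibleCircularCubic F)
    (a b c d : RegularPoint F) :
    (∃ Q : MvPolynomial (Fin 3) ℝ, IsGeneralisedCircle Q ∧ IntersectsExactlyIn F Q {a, b, c, d}) ↔
      groupSum hF (groupSum hF (groupSum hF a b) c) d = omegaPoint hF := by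
  rw [hF.groupSum_eq_omegaPoint_iff]
  have h₁ : IsLineSection F a b (thirdPoint a b) := hF.thirdPoint_eq_iff.1 rfl
  have h₂ : IsLineSection F c d (thirdPoint c d) := hF.thirdPoint_eq_iff.1 rfl
  constructor
  · rintro ⟨Q, hQ, hQF⟩
    exact hF.isLineSection_of_generalisedCircle h₁ h₂ hQ hQF
  · exact hF.exists_generalisedCircle h₁ h₂
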